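/- **Conventions.** Locally convex spaces are real and Hausdorff. A subset $R$ of a locally convex space $E$ is *regular* if its interior $R^0$ is dense in $R$. Let $F$ be a locally convex space. A map $f\colon R\to F$ is $C^0$ if it is continuous; it is $C^1$ if it is continuous, the directional derivatives $d f(x,y)=\frac{d}{dt}|_{t=0}f(x+ty)$ exist for all $(x,y)\in R^0\times E$, and $(x,y)\mapsto df(x,y)$ has a (unique) continuous extension $df\colon R\times E\to F$; for $\ell\ge 2$ it is $C^\ell$ if it is $C^1$ and $df\colon R\times E\to F$ is $C^{\ell-1}$ (on the regular subset $R\times E$ of $E\times E$); it is $C^\infty$ if it is $C^\ell$ for all $\ell\in\mathbb N_0$. For a $C^\ell$-map $f$ and $j\in\mathbb N_0$ with $j\le\ell$, let $d^{(j)}f\colon R\times E^j\to F$ be the continuous extension of $R^0\times E^j\to F$, $(x,y_1,\dots,y_j)\mapsto (D_{y_j}\cdots D_{y_1}f)(x)$. The *compact-open $C^\ell$-topology* on the vector space $C^\ell(R,F)$ of all $C^\ell$-maps $R\to F$ is the initial topology with respect to the maps $d^{(j)}\colon C^\ell(R,F)\to C(R\times E^j,F)$ for $j\le \ell$, where $C(R\times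 E^j,F)$ carries the compact-open topology. **Hanusch's extension operators.** Let $-\infty\le a<\tau<b<\infty$. Let $(c_k)_{k\ge0}$ and $(m_k)_{k\ge0}$ be real sequences with $m_k<0$ for all $k$, $m_k\to-\infty$, $\sum_k|c_k|\,|m_k|^n<\infty$ and $\sum_k c_k m_k^n=1$ for all $n\in\mathbb N_0$ (such sequences exist, for instance with $m_k=-2^k$). Let $\rho\colon\mathbb R\to\mathbb R$ be a smooth function with $\rho=0$ on $]-\infty,\tau]$ and $\rho=1$ on a neighbourhood of $b$. For a function $\gamma\colon\,]a,b]\times R\to F$, define $\mathcal E_\tau(\gamma)\colon\,]a,\infty[\,\times R\to F$ by $\mathcal E_\tau(\gamma)(t,x)=\gamma(t,x)$ for $t\le b$ and $$\mathcal E_\tau(\gamma)(t,x)=\sum_{k=0}^\infty c_k\,\rho(b+m_k(t-b))\,\gamma(b+m_k(t-b),x)\qquad\text{for } t>b,$$ a sum with only finitely many non-zero terms, where a term is read as $0$ if $b+m_k(t-b)\le a$. **Proposition 1.7.** Let $\ell\in\mathbb N_0\cup\{\infty\}$, let $E$ and $F$ be locally convex spaces, $R\subseteq E$ a regular subset, and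 $-\infty\le a<\tau<b<\infty$. Then, for all $(c_k)$, $(m_k)$ and $\rho$ as above, $\gamma\mapsto\mathcal E_\tau(\gamma)$ is a linear map $$\mathcal E_\tau\colon C^\ell(]a,b]\times R,F)\to C^\ell(]a,\infty[\,\times R,F)$$ which is a right inverse for the restriction map, and it is continuous if the compact-open $C^\ell$-topology is used on domain and range. -/

import Mathlib

open Filter Topology Set

namespace Bastiani

noncomputable section

universe u v

/-! ### Regular subsets and differential calculus on them -/

/-- A subset of a topological space is regular if its interior is dense in it. -/
def IsRegularSubset {X : Type*} [TopologicalSpace X] (R : Set X) : Prop :=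
  R ⊆ closure (interior R)

section Calculus

variable {E : Type u} [AddCommGroup E] [Module ℝ E] [TopologicalSpace E]
variable {F : Type v} [AddCommGroup F] [Module ℝ F] [TopologicalSpace F]

/-- The difference quotient `t⁻¹ (f (x + t v) - f x)`. -/
def diffQuot (f : E → F) (x v : E) (t : ℝ) : F := t⁻¹ • (f (x + t • v) - f x)

/-- `f` has the directional derivative `w` at `x` in the direction `v`. -/
def HasDirDerivAt (f : E → F) (x v : E) (w : F) : Prop :=
  Tendsto (diffQuot f x v) (𝓝[≠] 0) (𝓝 w)

/-- `df`, which matters on `R × E` only, is the differential of `f` on `R`: it is continuous on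
`R × E`, and on `R⁰ × E` it is given by the directional derivatives of `f`. -/
structure IsDifferentialOn (R : Set E) (f : E → F) (df : E × E → F) : Prop where
  continuousOn : ContinuousOn df (R ×ˢ univ)
  hasDirDerivAt : ∀ x ∈ interior R, ∀ v : E, HasDirDerivAt f x v (df (x, v))

/-- `f` is `C^n` on `R` for finite `n` (only the values of `f` on `R` matter):
`C^0` means continuous, and `C^{n+1}` means that `f` is continuous and has a differential
`df : R × E → F` (the continuous extension of the differential on `R⁰ × E`) which is `C^n` on the
subset `R × E` of `E × E`. -/
def IsCkOn {F : Type v} [AddCommGroup F] [Module ℝ F] [TopologicalSpace F] :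
    ℕ → ∀ {E : Type u} [AddCommGroup E] [Module ℝ E] [TopologicalSpace E],
      Set E → (E → F) → Prop
  | 0, _, _, _, _, R, f => ContinuousOn f R
  | n + 1, E, _, _, _, R, f =>
      ContinuousOn f R ∧ ∃ df : E × E → F,
        IsDifferentialOn R f df ∧ IsCkOn n (R ×ˢ (univ : Set E)) df

/-- Extension of a function on `R` to the ambient space by `0`. -/
def zeroExt {R : Set E} (γ : R → F) : E → F :=
  Function.extend Subtype.val γ 0

/-- The directional derivative (meaningful where it exists). -/
def dirDeriv (v : E) (f : E → F) (x : E) : F := limUnder (𝓝[≠] (0 : ℝ)) (diffQuot f x v)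

/-- The iterated directional derivative
`(D_{y_{j-1}} ⋯ D_{y_0} f) (x)`; the direction `y 0` is applied first. -/
def iterDirDeriv : ∀ j : ℕ, (Fin j → E) → (E → F) → E → F
  | 0, _, f => f
  | j + 1, y, f => iterDirDeriv j (fun i => y i.succ) (dirDeriv (y 0) f)

/-- `d^{(j)} f` on `R × E^j`: the continuous extension of the function
`(x, y) ↦ (D_{y_{j-1}} ⋯ D_{y_0} f) (x)` on `R⁰ × E^j`. -/
def iterDiff (j : ℕ) (R : Set E) (f : E → F) : E × (Fin j → E) → F :=
  extendFrom (interior R ×ˢ univ) fun p => iterDirDeriv j p.2 f p.1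

end Calculus

section Lemmas

variable {F : Type v} [AddCommGroup F] [Module ℝ F] [TopologicalSpace F]

theorem IsCkOn.continuousOn {n : ℕ} {E : Type u} [AddCommGroup E] [Module ℝ E]
    [TopologicalSpace E] {R : Set E} {f : E → F} (h : IsCkOn n R f) : ContinuousOn f R := by
  cases n with
  | zero => exact h
  | succ n => exact h.1

theorem HasDirDerivAt.add [IsTopologicalAddGroup F] {E : Type u} [AddCommGroup E] [Module ℝ E]
    [TopologicalSpace E] {f g : E → F} {x v : E} {w w' : F}
    (hf : HasDirDerivAt f x v w) (hg : HasDirDerivAt g x v w') :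
    HasDirDerivAt (f + g) x v (w + w') := by
  refine (Tendsto.add hf hg).congr fun t => ?_
  simp only [diffQuot, Pi.add_apply, ← smul_add]
  congr 1
  abel

theorem HasDirDerivAt.const_smul [ContinuousSMul ℝ F] {E : Type u} [AddCommGroup E] [Module ℝ E]
    [TopologicalSpace E] {f : E → F} {x v : E} {w : F} (c : ℝ)
    (hf : HasDirDerivAt f x v w) : HasDirDerivAt (c • f) x v (c • w) := by
  refine (Tendsto.const_smul hf c).congr fun t => ?_
  simp only [diffQuot, Pi.smul_apply, ← smul_sub]
  rw [smul_comm]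

theorem IsCkOn.add [IsTopologicalAddGroup F] (n : ℕ) : ∀ {E : Type u} [AddCommGroup E] [Module ℝ E]
    [TopologicalSpace E] {R : Set E} {f g : E → F},
    IsCkOn n R f → IsCkOn n R g → IsCkOn n R (f + g) := by
  induction n with
  | zero => intro E _ _ _ R f g hf hg; exact ContinuousOn.add hf hg
  | succ n ih =>
    rintro E _ _ _ R f g ⟨hf, df, hdf, hf'⟩ ⟨hg, dg, hdg, hg'⟩
    exact ⟨hf.add hg, df + dg, ⟨hdf.1.add hdg.1,
      fun x hx v => (hdf.2 x hx v).add (hdg.2 x hx v)⟩, ih hf' hg'⟩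

theorem IsCkOn.const_smul [ContinuousSMul ℝ F] (n : ℕ) (c : ℝ) : ∀ {E : Type u} [AddCommGroup E]
    [Module ℝ E] [TopologicalSpace E] {R : Set E} {f : E → F},
    IsCkOn n R f → IsCkOn n R (c • f) := by
  induction n with
  | zero => intro E _ _ _ R f hf; exact ContinuousOn.const_smul hf c
  | succ n ih =>
    rintro E _ _ _ R f ⟨hf, df, hdf, hf'⟩
    exact ⟨hf.const_smul c, c • df, ⟨hdf.1.const_smul c,
      fun x hx v => (hdf.2 x hx v).const_smul c⟩, ih hf'⟩

theorem isCkOn_zero (n : ℕ) : ∀ {E : Type u} [AddCommGroup E] [Module ℝ E]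
    [TopologicalSpace E] {R : Set E}, IsCkOn n R (0 : E → F) := by
  induction n with
  | zero => intro E _ _ _ R; exact continuousOn_const
  | succ n ih =>
    intro E _ _ _ R
    refine ⟨continuousOn_const, 0, ⟨continuousOn_const, fun x _ v => ?_⟩, ih⟩
    refine tendsto_const_nhds.congr fun t => ?_
    simp [diffQuot]

theorem dirDeriv_congr {E : Type u} [AddCommGroup E] [Module ℝ E] [TopologicalSpace E]
    [ContinuousAdd E] [ContinuousSMul ℝ E] {U : Set E} (hU : IsOpen U)
    {h : E → F} {k : E × E → F} {z : E} (hk : ∀ x ∈ U, h x = k (x, z)) (y : E) :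
    ∀ x ∈ U, dirDeriv y h x = dirDeriv ((y, 0) : E × E) k (x, z) := by
  intro x hx
  have hev : ∀ᶠ t : ℝ in 𝓝[≠] 0, diffQuot h x y t = diffQuot k (x, z) (y, 0) t := by
    have hc : Continuous fun t : ℝ => x + t • y := by fun_prop
    have hm : ∀ᶠ t : ℝ in 𝓝 0, x + t • y ∈ U :=
      hc.continuousAt.eventually (hU.mem_nhds (by simpa using hx))
    filter_upwards [hm.filter_mono nhdsWithin_le_nhds] with t ht
    simp [diffQuot, hk _ ht, hk _ hx]
  unfold dirDeriv limUnder
  rw [map_congr hev]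

theorem iterDirDeriv_congr (n : ℕ) {E : Type u} [AddCommGroup E] [Module ℝ E] [TopologicalSpace E]
    [ContinuousAdd E] [ContinuousSMul ℝ E] {U : Set E} (hU : IsOpen U) {z : E} :
    ∀ {h : E → F} {k : E × E → F}, (∀ x ∈ U, h x = k (x, z)) → ∀ (y : Fin n → E), ∀ x ∈ U,
    iterDirDeriv n y h x = iterDirDeriv n (fun i => ((y i, 0) : E × E)) k (x, z) := by
  induction n with
  | zero => intro h k hk y x hx; exact hk x hx
  | succ n ih =>
    intro h k hk y x hx
    exact ih (dirDeriv_congr hU hk (y 0)) (fun i => y i.succ) x hx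

/-- For a `C^n` map, the `n`-th iterated directional derivatives on `R⁰ × E^n` extend
continuously to `R × E^n`. -/
theorem IsCkOn.exists_continuousOn [T2Space F] (n : ℕ) : ∀ {E : Type u} [AddCommGroup E]
    [Module ℝ E] [TopologicalSpace E] [ContinuousAdd E] [ContinuousSMul ℝ E] {R : Set E}
    {f : E → F}, IsCkOn n R f → ∃ g : E × (Fin n → E) → F, ContinuousOn g (R ×ˢ univ) ∧
      ∀ p ∈ interior R ×ˢ (univ : Set (Fin n → E)), g p = iterDirDeriv n p.2 f p.1 := by
  induction n with
  | zero =>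
    intro E _ _ _ _ _ R f hf
    exact ⟨fun p => f p.1, ContinuousOn.comp hf continuousOn_fst fun p hp => hp.1,
      fun p _ => rfl⟩
  | succ n ih =>
    rintro E _ _ _ _ _ R f ⟨hf, df, hdf, hn⟩
    obtain ⟨g, hg, hgi⟩ := ih hn
    refine ⟨fun p => g ((p.1, p.2 0), fun i => (p.2 i.succ, 0)), ?_, ?_⟩
    · refine hg.comp (by fun_prop) ?_
      intro p hp
      exact ⟨⟨hp.1, mem_univ _⟩, mem_univ _⟩
    · rintro ⟨x, y⟩ ⟨hx, -⟩
      have hi : ((x, y 0), fun i : Fin n => ((y i.succ, 0) : E × E)) ∈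
          interior (R ×ˢ (univ : Set E)) ×ˢ (univ : Set (Fin n → E × E)) := by
        refine ⟨?_, mem_univ _⟩
        rw [interior_prod_eq, interior_univ]
        exact ⟨hx, mem_univ _⟩
      refine (hgi _ hi).trans ?_
      refine (iterDirDeriv_congr n isOpen_interior (h := dirDeriv (y 0) f) ?_ _ x hx).symm
      intro x' hx'
      exact (hdf.2 x' hx' (y 0)).limUnder_eq

theorem IsCkOn.continuousOn_iterDiff [IsTopologicalAddGroup F] [T2Space F] {n : ℕ} {E : Type u}
    [AddCommGroup E] [Module ℝ E] [TopologicalSpace E] [ContinuousAdd E] [ContinuousSMul ℝ E]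
    {R : Set E} (hR : IsRegularSubset R) {f : E → F} (h : IsCkOn n R f) :
    ContinuousOn (iterDiff n R f) (R ×ˢ univ) := by
  obtain ⟨g, hg, hgi⟩ := h.exists_continuousOn
  refine continuousOn_extendFrom ?_ ?_
  · rw [closure_prod_eq, closure_univ]
    exact prod_mono hR subset_rfl
  · intro p hp
    refine ⟨g p, ?_⟩
    have h1 : Tendsto g (𝓝[interior R ×ˢ univ] p) (𝓝 (g p)) :=
      (hg p hp).mono_left (nhdsWithin_mono _ (prod_mono interior_subset subset_rfl))
    refine h1.congr' ?_
    filter_upwards [self_mem_nhdsWithin] with q hq using hgi q hq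

end Lemmas

theorem zeroExt_add {F : Type v} [AddCommGroup F] {E : Type u} [AddCommGroup E] {R : Set E} (γ η : R → F) :
    zeroExt (γ + η) = zeroExt γ + zeroExt η := by
  funext x
  by_cases hx : x ∈ R
  · simp [zeroExt, Subtype.val_injective.extend_apply _ _ (⟨x, hx⟩ : R)]
  · have h : ¬ ∃ y : R, (y : E) = x := by rintro ⟨y, rfl⟩; exact hx y.2
    simp [zeroExt, Function.extend_apply' _ _ _ h]

theorem zeroExt_smul {F : Type v} [AddCommGroup F] [Module ℝ F] {E : Type u} [AddCommGroup E] {R : Set E} (c : ℝ) (γ : R → F) :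
    zeroExt (c • γ) = c • zeroExt γ := by
  funext x
  by_cases hx : x ∈ R
  · simp [zeroExt, Subtype.val_injective.extend_apply _ _ (⟨x, hx⟩ : R)]
  · have h : ¬ ∃ y : R, (y : E) = x := by rintro ⟨y, rfl⟩; exact hx y.2
    simp [zeroExt, Function.extend_apply' _ _ _ h]

theorem zeroExt_zero {F : Type v} [AddCommGroup F] [Module ℝ F] {E : Type u} [AddCommGroup E] {R : Set E} :
    zeroExt (0 : R → F) = 0 := by
  simpa using zeroExt_smul (0 : ℝ) (0 : R → F)

/-! ### The function space `C^ℓ(R, F)` and its topology -/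

section Space

variable {E : Type u} [AddCommGroup E] [Module ℝ E] [TopologicalSpace E]

/-- The vector space `C^ℓ(R, F)` of all `C^ℓ`-functions `R → F`, for `ℓ ∈ ℕ₀ ∪ {∞}`. -/
def CkSpace (ℓ : ℕ∞) (R : Set E) (F : Type v) [AddCommGroup F] [Module ℝ F] [TopologicalSpace F]
    [IsTopologicalAddGroup F] [ContinuousSMul ℝ F] : Submodule ℝ (R → F) where
  carrier := {γ | ∀ n : ℕ, (n : ℕ∞) ≤ ℓ → IsCkOn n R (zeroExt γ)}
  add_mem' {γ η} hγ hη n hn := by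
    rw [zeroExt_add]
    exact (hγ n hn).add n (hη n hn)
  zero_mem' n _ := by
    rw [zeroExt_zero]
    exact isCkOn_zero n
  smul_mem' c γ hγ n hn := by
    rw [zeroExt_smul]
    exact (hγ n hn).const_smul n c

variable {F : Type v} [AddCommGroup F] [Module ℝ F] [TopologicalSpace F]
  [IsTopologicalAddGroup F] [ContinuousSMul ℝ F] [T2Space F]
  [ContinuousAdd E] [ContinuousSMul ℝ E]

/-- The map `d^{(j)} : C^ℓ(R, F) → C(R × E^j, F)` for `j ≤ ℓ`. -/
def CkSpace.d {ℓ : ℕ∞} {R : Set E} (hR : IsRegularSubset R) (j : ℕ) (hj : (j : ℕ∞) ≤ ℓ)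
    (γ : CkSpace ℓ R F) : C(R × (Fin j → E), F) where
  toFun p := iterDiff j R (zeroExt γ.1) (p.1, p.2)
  continuous_toFun :=
    (IsCkOn.continuousOn_iterDiff hR (γ.2 j hj)).comp_continuous (by fun_prop)
      fun p => ⟨p.1.2, mem_univ _⟩

/-- The compact-open `C^ℓ`-topology: the initial topology with respect to the maps
`d^{(j)} : C^ℓ(R, F) → C(R × E^j, F)`, `j ≤ ℓ`, where spaces of continuous maps carry the
compact-open topology. -/
abbrev ckTopology (ℓ : ℕ∞) {R : Set E} (hR : IsRegularSubset R) :
    TopologicalSpace (CkSpace ℓ R F) :=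
  ⨅ (j : ℕ) (hj : (j : ℕ∞) ≤ ℓ),
    TopologicalSpace.induced (CkSpace.d hR j hj) ContinuousMap.compactOpen

end Space

/-! ### Hanusch's extension operators -/

section Domains

variable {E : Type u}

/-- `]a, b] × R`, where `a = -∞` is allowed. -/
def leftDomain (a : EReal) (b : ℝ) (R : Set E) : Set (ℝ × E) :=
  {t : ℝ | a < (t : EReal) ∧ t ≤ b} ×ˢ R

/-- `]a, ∞[ × R`, where `a = -∞` is allowed. -/
def rightDomain (a : EReal) (R : Set E) : Set (ℝ × E) :=
  {t : ℝ | a < (t : EReal)} ×ˢ R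

theorem leftDomain_subset_rightDomain (a : EReal) (b : ℝ) (R : Set E) :
    leftDomain a b R ⊆ rightDomain a R :=
  fun _ hp => ⟨hp.1.1, hp.2⟩

theorem isOpen_coe_gt (a : EReal) : IsOpen {t : ℝ | a < (t : EReal)} :=
  isOpen_Ioi.preimage continuous_coe_real_ereal

variable [TopologicalSpace E]

theorem IsRegularSubset.prod {X Y : Type*} [TopologicalSpace X] [TopologicalSpace Y]
    {R : Set X} {S : Set Y} (hR : IsRegularSubset R) (hS : IsRegularSubset S) :
    IsRegularSubset (R ×ˢ S) := by
  unfold IsRegularSubset at *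
  rw [interior_prod_eq, closure_prod_eq]
  exact prod_mono hR hS

theorem isRegularSubset_rightDomain {R : Set E} (hR : IsRegularSubset R) (a : EReal) :
    IsRegularSubset (rightDomain a R) := by
  refine IsRegularSubset.prod ?_ hR
  unfold IsRegularSubset
  rw [(isOpen_coe_gt a).interior_eq]
  exact subset_closure

theorem isRegularSubset_leftDomain {R : Set E} (hR : IsRegularSubset R) (a : EReal) (b : ℝ) :
    IsRegularSubset (leftDomain a b R) := by
  refine IsRegularSubset.prod ?_ hR
  intro t ht
  have h1 : {s : ℝ | a < (s : EReal)} ∩ Iio b ⊆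
      interior {s : ℝ | a < (s : EReal) ∧ s ≤ b} :=
    interior_maximal (fun s hs => ⟨hs.1, le_of_lt hs.2⟩) ((isOpen_coe_gt a).inter isOpen_Iio)
  have h2 : t ∈ closure (Iio b) := by
    rw [closure_Iio]
    exact ht.2
  exact closure_mono h1 ((isOpen_coe_gt a).inter_closure ⟨ht.1, h2⟩)

end Domains

/-- Seeley's reflection data: weights `c k` and slopes `m k < 0` with `m k → -∞` such that
`∑ |c k| |m k| ^ n < ∞` and `∑ c k (m k) ^ n = 1` for all `n ∈ ℕ₀`. -/
structure SeeleySequence where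
  /-- the weights -/
  c : ℕ → ℝ
  /-- the (negative) slopes of the reflections -/
  m : ℕ → ℝ
  m_neg : ∀ k, m k < 0
  m_tendsto : Tendsto m atTop atBot
  summable : ∀ n : ℕ, Summable fun k => |c k| * |m k| ^ n
  hasSum_moment : ∀ n : ℕ, HasSum (fun k => c k * m k ^ n) 1

/-- Interpolation weights: `∑_{k<N} seeleyApprox N k (-2^k)^n = 1` for `n < N`. -/
def seeleyApprox (N k : ℕ) : ℝ :=
  if k < N then ∏ i ∈ (Finset.range N).erase k, (1 + (2 : ℝ) ^ i) / (2 ^ i - 2 ^ k) else 0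

/-- A bound for the interpolation weights which is uniform in `N`. -/
def seeleyBound (k : ℕ) : ℝ := Real.exp 8 * ∏ i ∈ Finset.range k, (4 / (2 : ℝ) ^ (i + 1))

theorem seeleyApprox_moment {n N : ℕ} (h : n < N) :
    ∑ k ∈ Finset.range N, seeleyApprox N k * (-(2 : ℝ) ^ k) ^ n = 1 := by
  have hinj : Set.InjOn (fun k : ℕ => -(2 : ℝ) ^ k) (Finset.range N : Set ℕ) := by
    intro i _ j _ hij
    exact pow_right_injective₀ (by norm_num : (0:ℝ) < 2) (by norm_num) (neg_injective hij)
  have hdeg : (Polynomial.X ^ n : Polynomial ℝ).degree < (Finset.range N).card := by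
    simpa using h
  have key := congrArg (Polynomial.eval 1) (Lagrange.eq_interpolate hinj hdeg)
  rw [Lagrange.interpolate_apply, Polynomial.eval_finsetSum] at key
  simp only [Polynomial.eval_pow, Polynomial.eval_X, one_pow, Polynomial.eval_mul,
    Polynomial.eval_C] at key
  rw [key]
  refine Finset.sum_congr rfl fun k hk => ?_
  rw [mul_comm, seeleyApprox, if_pos (Finset.mem_range.1 hk), Lagrange.basis,
    Polynomial.eval_prod]
  congr 1
  refine Finset.prod_congr rfl fun i _ => ?_
  simp only [Lagrange.basisDivisor, Polynomial.eval_mul, Polynomial.eval_C, Polynomial.eval_sub,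
    Polynomial.eval_X]
  rw [div_eq_inv_mul]
  congr 1 <;> ring

theorem abs_seeleyApprox_le (N k : ℕ) : |seeleyApprox N k| ≤ seeleyBound k := by
  unfold seeleyApprox seeleyBound
  split_ifs with hk
  swap
  · simp only [abs_zero]; positivity
  have hu : (Finset.range N).erase k = Finset.range k ∪ Finset.Ico (k + 1) N := by
    ext i; simp; omega
  have hd : Disjoint (Finset.range k) (Finset.Ico (k + 1) N) := by
    rw [Finset.disjoint_left]; intro i hi; simp at hi ⊢; omega
  rw [Finset.abs_prod, hu, Finset.prod_union hd, mul_comm]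
  refine mul_le_mul ?_ ?_ (Finset.prod_nonneg fun _ _ => abs_nonneg _) (Real.exp_pos _).le
  · have h1 : ∀ i ∈ Finset.Ico (k + 1) N, |(1 + (2 : ℝ) ^ i) / (2 ^ i - 2 ^ k)| ≤
        Real.exp (4 * (1 / 2) ^ (i - k)) := by
      intro i hi
      obtain ⟨d, rfl⟩ : ∃ d, i = k + 1 + d := ⟨i - (k + 1), by simp only [Finset.mem_Ico, Finset.mem_range] at hi; omega⟩
      have hk1 : (1 : ℝ) ≤ 2 ^ k := one_le_pow₀ (by norm_num)
      have hd1 : (1 : ℝ) ≤ 2 ^ d := one_le_pow₀ (by norm_num)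
      have hpos : (0 : ℝ) < 2 ^ (k + 1 + d) - 2 ^ k := by
        rw [pow_add, pow_add]; nlinarith
      rw [abs_of_nonneg (by positivity)]
      refine le_trans ?_ (Real.add_one_le_exp _)
      rw [div_le_iff₀ hpos]
      have e : k + 1 + d - k = d + 1 := by omega
      rw [e, pow_succ, one_div, inv_pow, pow_add, pow_add]
      have hdi : ((2 : ℝ) ^ d)⁻¹ * 2 ^ d = 1 := inv_mul_cancel₀ (by positivity)
      have hdi1 : ((2 : ℝ) ^ d)⁻¹ ≤ 1 := inv_le_one_of_one_le₀ hd1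
      nlinarith [mul_nonneg (sub_nonneg.2 hdi1) (by positivity : (0:ℝ) ≤ 2 ^ k)]
    refine (Finset.prod_le_prod (fun _ _ => abs_nonneg _) h1).trans ?_
    rw [← Real.exp_sum, Real.exp_le_exp, ← Finset.mul_sum]
    have h2 : ∑ i ∈ Finset.Ico (k + 1) N, (1 / 2 : ℝ) ^ (i - k) ≤ 2 := by
      rw [Finset.sum_Ico_eq_sum_range]
      have h3 : ∀ j ∈ Finset.range (N - (k + 1)), (1 / 2 : ℝ) ^ (k + 1 + j - k) ≤ (1 / 2) ^ j := by
        intro j _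
        exact pow_le_pow_of_le_one (by norm_num) (by norm_num) (by omega)
      exact (Finset.sum_le_sum h3).trans (sum_geometric_two_le _)
    linarith
  · rw [← Finset.prod_range_reflect]
    refine Finset.prod_le_prod (fun _ _ => abs_nonneg _) fun i hi => ?_
    obtain ⟨d, rfl⟩ : ∃ d, k = i + 1 + d := ⟨k - (i + 1), by simp only [Finset.mem_Ico, Finset.mem_range] at hi; omega⟩
    have e : i + 1 + d - 1 - i = d := by omega
    have hi1 : (1 : ℝ) ≤ 2 ^ i := one_le_pow₀ (by norm_num)
    have hd1 : (1 : ℝ) ≤ 2 ^ d := one_le_pow₀ (by norm_num)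
    rw [e, abs_div, div_le_div_iff₀ (by
      rw [abs_pos]; rw [pow_add, pow_add]; nlinarith) (by positivity),
      abs_of_nonneg (by positivity), abs_of_nonpos (by rw [pow_add, pow_add]; nlinarith)]
    simp only [pow_add, pow_one]
    nlinarith [mul_nonneg (sub_nonneg.2 hd1) (sub_nonneg.2 hi1)]

theorem summable_seeleyBound (n : ℕ) :
    Summable fun k => seeleyBound k * (2 ^ k : ℝ) ^ n := by
  have hp : ∀ k, 0 < seeleyBound k * (2 ^ k : ℝ) ^ n := fun k => by
    unfold seeleyBound; positivity
  refine summable_of_ratio_test_tendsto_lt_one (l := 0) (by norm_num)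
    (Eventually.of_forall fun k => (hp k).ne') ?_
  have h : ∀ k, ‖seeleyBound (k + 1) * (2 ^ (k + 1) : ℝ) ^ n‖ / ‖seeleyBound k * (2 ^ k : ℝ) ^ n‖
      = 2 * 2 ^ n * (1 / 2) ^ k := by
    intro k
    rw [Real.norm_of_nonneg (hp _).le, Real.norm_of_nonneg (hp _).le, div_eq_iff (hp k).ne']
    unfold seeleyBound
    rw [Finset.prod_range_succ, pow_succ (2 : ℝ) k, mul_pow, one_div, inv_pow]
    field_simp
    ring
  simp_rw [h]
  simpa using (tendsto_pow_atTop_nhds_zero_of_lt_one (by norm_num : (0:ℝ) ≤ 1 / 2)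
    (by norm_num)).const_mul (2 * 2 ^ n : ℝ)

/-- Such data exist (with the slopes `-2^k`). -/
instance : Nonempty SeeleySequence := by
  let U : Ultrafilter ℕ := hyperfilter ℕ
  have hU : (U : Filter ℕ) ≤ atTop := by
    rw [← Nat.cofinite_eq_atTop]; exact hyperfilter_le_cofinite
  have hex : ∀ k, ∃ x : ℝ, Tendsto (fun N => seeleyApprox N k) U (𝓝 x) := by
    intro k
    obtain ⟨x, -, hx⟩ := (isCompact_Icc (a := -seeleyBound k) (b := seeleyBound k)).ultrafilter_le_nhds
      (U.map fun N => seeleyApprox N k) (by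
        rw [le_principal_iff]
        change (fun N => seeleyApprox N k) ⁻¹' Icc (-seeleyBound k) (seeleyBound k) ∈ U
        have h : (fun N => seeleyApprox N k) ⁻¹' Icc (-seeleyBound k) (seeleyBound k) = univ :=
          eq_univ_of_forall fun N => abs_le.1 (abs_seeleyApprox_le N k)
        rw [h]
        exact Filter.univ_mem)
    exact ⟨x, hx⟩
  choose c hc using hex
  have hb : ∀ k, |c k| ≤ seeleyBound k := fun k => by
    have h : Tendsto (fun N => |seeleyApprox N k|) U (𝓝 |c k|) := (hc k).abs
    exact le_of_tendsto h (Eventually.of_forall fun N => abs_seeleyApprox_le N k)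
  have hs : ∀ n : ℕ, Summable fun k => |c k| * |(-(2:ℝ) ^ k)| ^ n := by
    intro n
    refine Summable.of_nonneg_of_le (fun k => by positivity) (fun k => ?_) (summable_seeleyBound n)
    rw [abs_neg, abs_of_nonneg (by positivity : (0:ℝ) ≤ 2 ^ k)]
    exact mul_le_mul_of_nonneg_right (hb k) (by positivity)
  have hneg : ∀ k : ℕ, -(2 : ℝ) ^ k < 0 := fun k => neg_neg_of_pos (by positivity)
  refine ⟨⟨c, fun k => -(2 : ℝ) ^ k, hneg, tendsto_neg_atTop_atBot.comp
    (tendsto_pow_atTop_atTop_of_one_lt (by norm_num)), hs, fun n => ?_⟩⟩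
  have hs' : Summable fun k => c k * (-(2:ℝ) ^ k) ^ n := by
    refine Summable.of_norm ?_
    simpa [abs_mul, abs_pow] using hs n
  rw [hs'.hasSum_iff]
  have ht := tendsto_tsum_of_dominated_convergence (𝓕 := (U : Filter ℕ))
    (f := fun N k => seeleyApprox N k * (-(2:ℝ) ^ k) ^ n)
    (g := fun k => c k * (-(2:ℝ) ^ k) ^ n) (summable_seeleyBound n)
    (fun k => (hc k).mul_const _) (Eventually.of_forall fun N k => by
      rw [norm_mul, norm_pow, norm_neg, Real.norm_eq_abs, Real.norm_of_nonneg
        (by positivity : (0:ℝ) ≤ 2 ^ k)]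
      exact mul_le_mul_of_nonneg_right (abs_seeleyApprox_le N k) (by positivity))
  refine tendsto_nhds_unique ht (tendsto_const_nhds.congr' ?_)
  filter_upwards [hU (eventually_gt_atTop n)] with N hN
  rw [tsum_eq_sum (s := Finset.range N), seeleyApprox_moment hN]
  intro k hk
  simp only [Finset.mem_range] at hk
  simp [seeleyApprox, hk]

/-- A smooth cut-off function which vanishes on `]-∞, τ]` and equals `1` near `b`. -/
structure IsCutoff (τ b : ℝ) (ρ : ℝ → ℝ) : Prop where
  contDiff : ContDiff ℝ (⊤ : ℕ∞) ρ
  eq_zero : ∀ t ≤ τ, ρ t = 0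
  eq_one : ∀ᶠ t in 𝓝 b, ρ t = 1

/-- Cut-off functions exist. -/
theorem exists_isCutoff {τ b : ℝ} (h : τ < b) : ∃ ρ, IsCutoff τ b ρ := by
  refine ⟨fun t => Real.smoothTransition (2 * (t - τ) / (b - τ)), ?_, fun t ht => ?_, ?_⟩
  · exact Real.smoothTransition.contDiff.comp (by fun_prop)
  · exact Real.smoothTransition.zero_of_nonpos
      (div_nonpos_of_nonpos_of_nonneg (by linarith) (by linarith))
  · filter_upwards [lt_mem_nhds (show (τ + b) / 2 < b by linarith)] with t ht
    refine Real.smoothTransition.one_of_one_le ?_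
    rw [le_div_iff₀ (by linarith)]
    linarith

/-- The extension of `γ : ]a, b] × R → F` to `]a, ∞[ × R` by iterated reflection at `t = b`:
for `t > b`, it is the (locally finite) sum
`∑ c k * ρ (b + m k (t - b)) • γ (b + m k (t - b), x)`, where a summand is understood as zero if
`b + m k (t - b)` is not in the domain `]a, b]` (then `ρ` vanishes there). -/
def hanuschExt {E : Type u} {F : Type v} [AddCommGroup F] [Module ℝ F]
    (S : SeeleySequence) (ρ : ℝ → ℝ) {a : EReal} {b : ℝ} {R : Set E}
    (γ : leftDomain a b R → F) : rightDomain a R → F := fun p =>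
  open Classical in
  if h : p.1.1 ≤ b then γ ⟨p.1, ⟨p.2.1, h⟩, p.2.2⟩
  else ∑ᶠ k : ℕ, (S.c k * ρ (b + S.m k * (p.1.1 - b))) •
    zeroExt γ (b + S.m k * (p.1.1 - b), p.1.2)

end

end Bastiani

set_option linter.unusedSectionVars false

namespace Bastiani

universe u v w

/-! ### Directional derivatives and the mean value inequality. -/

section Derivatives

variable {E : Type u} [AddCommGroup E] [Module ℝ E] [TopologicalSpace E]
  [IsTopologicalAddGroup E] [ContinuousSMul ℝ E]
variable {F : Type v} [AddCommGroup F] [Module ℝ F] [TopologicalSpace F]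

/-! Away from t = b the extension is elementary: for t < b it is γ, and for t > b the sum is locally
finite, since m_k → -∞ pushes the reflected points below τ, where ρ vanishes. At t = b the
identities ∑ c_k m_k^n = 1 make the derivatives from both sides match; summability of |c_k| |m_k|^n
supplies the dominated convergence.

For an induction on the order, the operator is put into the family `seeleyOp S b i σ`, with weights
c_k m_k^i and with σ zero up to τ and constant near b; it extends σ(b) f. A derivative in t produces
a factor m_k, so i becomes i + 1, and falls on σ or on f; a derivative in E changes neither i nor σ.
So the differential (`seeleyDiff`) is built from operators of the same family. Order zero is
`continuousOn_seeleyOp` and `IsNullOn.seeleyOp`. The differential computed off t = b extends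
continuously across it, and the mean value inequality (`hasDirDerivAt_of_ne`) shows that it is the
differential there too.

Regularity of the extension and continuity of the operator are one statement, `IsCkNullOn.seeleyOp`:
families tending to zero in the C^n-sense along a filter are mapped to such families. The filter ⊥
gives preservation of C^n, the neighbourhood filter of γ₀ gives continuity at γ₀. This recursive
C^n-convergence is matched with the maps d^{(j)} by `isCkNullOn_of_iterDiff`, which rests on
multilinearity, and `IsCkNullOn.isNullOn_iterDiff`. Only finite orders n ≤ ℓ occur, so ℓ = ∞ needs
no extra argument. -/

theorem tendsto_of_seminorm [IsTopologicalAddGroup F] [ContinuousSMul ℝ F] [LocallyConvexSpace ℝ F]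
    {X : Type*} {l : Filter X} {u : X → F} {y : F}
    (h : ∀ p : Seminorm ℝ F, Continuous p → ∀ ε > 0, ∀ᶠ x in l, p (u x - y) < ε) :
    Tendsto u l (𝓝 y) := by
  have hp := with_gaugeSeminormFamily (𝕜 := ℝ) (E := F)
  rw [hp.tendsto_nhds u y]
  exact fun i ε hε => h _ (hp.continuous_seminorm i) ε hε

theorem eventually_seminorm_lt [IsTopologicalAddGroup F] {X : Type*} {l : Filter X} {u : X → F}
    {y : F} (h : Tendsto u l (𝓝 y)) {p : Seminorm ℝ F} (hp : Continuous p) {ε : ℝ} (hε : 0 < ε) :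
    ∀ᶠ x in l, p (u x - y) < ε := by
  have h1 : Tendsto (fun x => p (u x - y)) l (𝓝 (p (y - y))) :=
    (hp.tendsto _).comp (h.sub_const y)
  rw [sub_self, map_zero] at h1
  exact h1.eventually (gt_mem_nhds hε)

theorem HasDirDerivAt.congr_of_eventuallyEq {f g : E → F} {x v : E} {w : F}
    (hf : HasDirDerivAt f x v w) (h : f =ᶠ[𝓝 x] g) : HasDirDerivAt g x v w := by
  have hc : Tendsto (fun t : ℝ => x + t • v) (𝓝[≠] 0) (𝓝 x) := by
    have : Continuous fun t : ℝ => x + t • v := by fun_prop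
    simpa using (this.tendsto 0).mono_left nhdsWithin_le_nhds
  refine Tendsto.congr' ?_ hf
  filter_upwards [hc.eventually h] with t ht
  simp only [diffQuot, ht, h.eq_of_nhds]

theorem hasDirDerivAt_zero_dir (f : E → F) (x : E) : HasDirDerivAt f x 0 0 := by
  refine tendsto_const_nhds.congr fun t => ?_
  simp [diffQuot]

theorem HasDirDerivAt.smul_dir [ContinuousSMul ℝ F] {f : E → F} {x v : E} {w : F}
    (hf : HasDirDerivAt f x v w) (c : ℝ) : HasDirDerivAt f x (c • v) (c • w) := by
  rcases eq_or_ne c 0 with rfl | hc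
  · simpa using hasDirDerivAt_zero_dir f x
  have h1 : Tendsto (fun t : ℝ => t * c) (𝓝[≠] 0) (𝓝[≠] 0) := by
    refine tendsto_nhdsWithin_of_tendsto_nhds_of_eventually_within _ ?_ ?_
    · have : Continuous fun t : ℝ => t * c := by fun_prop
      simpa using (this.tendsto 0).mono_left nhdsWithin_le_nhds
    · filter_upwards [self_mem_nhdsWithin] with t ht
      exact mul_ne_zero ht hc
  refine ((hf.comp h1).const_smul c).congr fun t => ?_
  simp only [diffQuot, Function.comp, smul_smul]
  congr 1
  field_simp

theorem HasDirDerivAt.comp_affine {E' : Type*} [AddCommGroup E'] [Module ℝ E']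
    {f : E → F} {L : E' →ₗ[ℝ] E} {c : E} {x v : E'} {w : F}
    (hf : HasDirDerivAt f (L x + c) (L v) w) :
    HasDirDerivAt (fun z => f (L z + c)) x v w := by
  refine hf.congr fun t => ?_
  simp only [diffQuot, map_add, map_smul]
  congr 3
  abel_nf

theorem HasDirDerivAt.line {f : E → F} {x v : E} {w : F} {r : ℝ}
    (hf : HasDirDerivAt f (x + r • v) v w) : HasDirDerivAt (fun s : ℝ => f (x + s • v)) r 1 w := by
  refine hf.congr fun t => ?_
  simp only [diffQuot, smul_eq_mul, mul_one, add_smul, add_assoc]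

/-- The increment is t times a convergent quotient. This continuity along a line is all that the
product rule `HasDirDerivAt.smul` needs. -/
theorem HasDirDerivAt.tendsto_line [IsTopologicalAddGroup F] [ContinuousSMul ℝ F] {f : E → F}
    {x v : E} {w : F} (hf : HasDirDerivAt f x v w) :
    Tendsto (fun t : ℝ => f (x + t • v)) (𝓝 0) (𝓝 (f x)) := by
  have h0 : Tendsto (fun t : ℝ => t) (𝓝[≠] 0) (𝓝 0) := tendsto_id.mono_left nhdsWithin_le_nhds
  have h1 : Tendsto (fun t : ℝ => t • diffQuot f x v t + f x) (𝓝[≠] 0) (𝓝 (f x)) := by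
    simpa using (h0.smul hf).add_const (f x)
  have h2 : Tendsto (fun t : ℝ => f (x + t • v)) (𝓝[≠] 0) (𝓝 (f x)) := by
    refine h1.congr' ?_
    filter_upwards [self_mem_nhdsWithin] with t ht
    rw [diffQuot, smul_smul, mul_inv_cancel₀ ht, one_smul, sub_add_cancel]
  have h3 : ContinuousAt (fun t : ℝ => f (x + t • v)) 0 := by
    rw [continuousAt_iff_punctured_nhds]
    simpa using h2
  simpa [ContinuousAt] using h3

theorem HasDirDerivAt.smul [IsTopologicalAddGroup F] [ContinuousSMul ℝ F] {c : E → ℝ} {f : E → F}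
    {x v : E} {c' : ℝ} {w : F} (hc : HasDirDerivAt c x v c') (hf : HasDirDerivAt f x v w) :
    HasDirDerivAt (fun z => c z • f z) x v (c' • f x + c x • w) := by
  have h := (Tendsto.smul hc (hf.tendsto_line.mono_left nhdsWithin_le_nhds)).add
    (Tendsto.const_smul hf (c x))
  refine h.congr fun t => ?_
  simp only [diffQuot, smul_sub, sub_smul, smul_smul, smul_eq_mul, mul_sub, mul_comm (c x)]
  abel

theorem HasDirDerivAt.sum [IsTopologicalAddGroup F] {ι : Type*} {s : Finset ι} {f : ι → E → F}
    {x v : E} {w : ι → F} (h : ∀ i ∈ s, HasDirDerivAt (f i) x v (w i)) :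
    HasDirDerivAt (fun z => ∑ i ∈ s, f i z) x v (∑ i ∈ s, w i) := by
  refine (tendsto_finsetSum s h).congr fun t => ?_
  simp only [diffQuot, ← Finset.smul_sum, ← Finset.sum_sub_distrib]

/-- The mean value inequality, in the form of a closed convex set containing all derivatives. -/
theorem sub_mem_of_hasDirDerivAt [IsTopologicalAddGroup F] [ContinuousSMul ℝ F]
    [LocallyConvexSpace ℝ F] {φ φ' : ℝ → F} {C : Set F} (hC : Convex ℝ C) (hC' : IsClosed C)
    (h : ∀ r ∈ Icc (0 : ℝ) 1, HasDirDerivAt φ r 1 (φ' r)) (hm : ∀ r ∈ Icc (0 : ℝ) 1, φ' r ∈ C) :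
    φ 1 - φ 0 ∈ C := by
  by_contra hn
  -- Hahn–Banach separates the increment from C by a continuous functional, and the scalar mean
  -- value theorem applied to L ∘ φ contradicts the separation.
  obtain ⟨L, u, hu, hu'⟩ := geometric_hahn_banach_closed_point hC hC' hn
  have hd : ∀ r ∈ Icc (0 : ℝ) 1, HasDerivAt (fun s => L (φ s)) (L (φ' r)) r := by
    intro r hr
    rw [hasDerivAt_iff_tendsto_slope_zero]
    refine ((L.continuous.tendsto _).comp (h r hr)).congr fun t => ?_
    simp [diffQuot]
  obtain ⟨r, hr, he⟩ := exists_hasDerivAt_eq_slope (fun s => L (φ s)) (fun r => L (φ' r))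
    zero_lt_one (fun r hr => (hd r hr).continuousAt.continuousWithinAt)
    (fun r hr => hd r (Ioo_subset_Icc_self hr))
  have h1 := hu _ (hm r (Ioo_subset_Icc_self hr))
  rw [map_sub] at hu'
  simp only [sub_zero, div_one] at he
  linarith

/-- The base point varies together with the step, because difference quotients at points near `x`
are needed later. The segment stays close to `x` since balls about 0 in ℝ are stable under factors
from [0, 1]. -/
theorem eventually_segment {x v : E} {P : E → Prop} (hP : ∀ᶠ z in 𝓝 x, P z) :
    ∀ᶠ q : E × ℝ in 𝓝 (x, 0), ∀ r ∈ Icc (0 : ℝ) 1, P (q.1 + (r * q.2) • v) := by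
  have h2 : Tendsto (fun q : E × ℝ => q.1 + q.2 • v) (𝓝 (x, 0)) (𝓝 x) := by
    have : Continuous (fun q : E × ℝ => q.1 + q.2 • v) := by fun_prop
    simpa using this.tendsto (x, 0)
  have h3 := h2.eventually hP
  rw [nhds_prod_eq, Filter.eventually_prod_iff] at h3
  obtain ⟨P', hP', Q, hQ, hPQ⟩ := h3
  obtain ⟨δ, hδ, hQδ⟩ := Metric.eventually_nhds_iff_ball.1 hQ
  rw [nhds_prod_eq]
  filter_upwards [hP'.prod_mk (Metric.ball_mem_nhds (0 : ℝ) hδ)] with q ⟨hq, hq2⟩ r hr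
  refine hPQ hq (hQδ (r * q.2) ?_)
  rw [dist_zero_right] at hq2
  rw [mem_ball_zero_iff]
  rw [norm_mul, Real.norm_of_nonneg hr.1]
  exact (mul_le_of_le_one_left (norm_nonneg _) hr.2).trans_lt hq2

/-- Difference quotients along segments in a set are close to the differential. -/
theorem eventually_diffQuot_near [IsTopologicalAddGroup F] [ContinuousSMul ℝ F]
    [LocallyConvexSpace ℝ F] {f D : E → F} {V : Set E} {x v : E} (hD : ContinuousWithinAt D V x)
    (hd : ∀ z ∈ V, HasDirDerivAt f z v (D z)) {p : Seminorm ℝ F} (hp : Continuous p) {ε : ℝ}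
    (hε : 0 < ε) : ∀ᶠ q : E × ℝ in 𝓝 (x, 0), q.2 ≠ 0 →
      (∀ r ∈ Icc (0 : ℝ) 1, q.1 + (r * q.2) • v ∈ V) → p (diffQuot f q.1 v q.2 - D x) ≤ ε := by
  have h1 : ∀ᶠ z in 𝓝 x, z ∈ V → p (D z - D x) < ε :=
    eventually_nhdsWithin_iff.1 (eventually_seminorm_lt hD hp hε)
  filter_upwards [eventually_segment (v := v) h1]
  rintro ⟨y, h⟩ hQ h0 hV
  simp only at hQ h0 hV ⊢
  -- Rescaling the direction to h • v parametrises the segment by [0, 1]. The derivatives then lie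
  -- in the ball about h • D x of radius |h| ε; the factor |h| cancels at the end.
  have key := sub_mem_of_hasDirDerivAt (φ := fun s : ℝ => f (y + s • (h • v)))
    (φ' := fun r => h • D (y + r • (h • v))) (C := p.closedBall (h • D x) (|h| * ε))
    (p.convex_closedBall _ _)
    (by
      have : p.closedBall (h • D x) (|h| * ε) = (fun z => p (z - h • D x)) ⁻¹' Iic (|h| * ε) := by
        ext z; simp [Seminorm.mem_closedBall]
      rw [this]
      exact isClosed_Iic.preimage (hp.comp (continuous_id.sub continuous_const)))
    (fun r hr => by
      have := hV r hr
      rw [← smul_smul] at this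
      exact ((hd _ this).smul_dir h).line)
    (fun r hr => by
      have hv := hV r hr
      have hlt := hQ r hr hv
      rw [Seminorm.mem_closedBall, ← smul_sub, map_smul_eq_mul, Real.norm_eq_abs, smul_smul]
      exact mul_le_mul_of_nonneg_left hlt.le (abs_nonneg h))
  rw [Seminorm.mem_closedBall] at key
  have e : f (y + (1 : ℝ) • h • v) - f (y + (0 : ℝ) • h • v) - h • D x =
      h • (diffQuot f y v h - D x) := by
    rw [diffQuot, smul_sub, smul_inv_smul₀ h0]
    simp
  rw [e, map_smul_eq_mul, Real.norm_eq_abs] at key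
  exact le_of_mul_le_mul_left key (abs_pos.2 h0)

/-- The directional derivatives of a function with continuous differential are additive. -/
theorem HasDirDerivAt.add_dir [IsTopologicalAddGroup F] [ContinuousSMul ℝ F]
    [LocallyConvexSpace ℝ F] {f D : E → F} {U : Set E} (hU : IsOpen U) {x v w : E} {a : F}
    (hx : x ∈ U) (hD : ContinuousOn D U) (hd : ∀ z ∈ U, HasDirDerivAt f z w (D z))
    (hv : HasDirDerivAt f x v a) : HasDirDerivAt f x (v + w) (a + D x) := by
  -- The increment along v + w is split at x + t • v. The second piece is a quotient with a moving
  -- base point, controlled by `eventually_diffQuot_near`.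
  have h1 : Tendsto (fun t : ℝ => diffQuot f (x + t • v) w t) (𝓝[≠] 0) (𝓝 (D x)) := by
    refine tendsto_of_seminorm fun p hp ε hε => ?_
    have hc' : Tendsto (fun t : ℝ => ((x + t • v, t) : E × ℝ)) (𝓝 0) (𝓝 (x, 0)) := by
      have : Continuous (fun t : ℝ => ((x + t • v, t) : E × ℝ)) := by fun_prop
      simpa using this.tendsto 0
    have hc := hc'.mono_left (nhdsWithin_le_nhds (s := {0}ᶜ))
    have hin : ∀ᶠ t : ℝ in 𝓝 0, ∀ r ∈ Icc (0 : ℝ) 1, x + t • v + (r * t) • w ∈ U := by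
      simpa using hc'.eventually (eventually_segment (v := w) (P := (· ∈ U)) (hU.mem_nhds hx))
    filter_upwards [hc.eventually (eventually_diffQuot_near (hD x hx) hd hp (half_pos hε)),
      self_mem_nhdsWithin, hin.filter_mono nhdsWithin_le_nhds] with t ht ht0 htU
    exact (ht ht0 htU).trans_lt (half_lt_self hε)
  refine (Tendsto.add hv h1).congr fun t => ?_
  simp only [diffQuot, ← smul_add, add_assoc]
  congr 1
  abel

end Derivatives

/-! ### Linearity of the differential, and differentiability across a hyperplane. -/

section Linearity

variable {E : Type u} [AddCommGroup E] [Module ℝ E] [TopologicalSpace E]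
  [IsTopologicalAddGroup E] [ContinuousSMul ℝ E]
variable {F : Type v} [AddCommGroup F] [Module ℝ F] [TopologicalSpace F]
  [IsTopologicalAddGroup F] [ContinuousSMul ℝ F] [T2Space F]

theorem HasDirDerivAt.unique {f : E → F} {x v : E} {w w' : F} (h : HasDirDerivAt f x v w)
    (h' : HasDirDerivAt f x v w') : w = w' :=
  tendsto_nhds_unique h h'

/-- Density of the interior: identities between continuous extensions need checking only where
genuine directional derivatives exist. -/
theorem eqOn_prod_univ_of_interior {X Y Z : Type*} [TopologicalSpace X] [TopologicalSpace Y]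
    [TopologicalSpace Z] [T2Space Z]
    {R : Set X} (hR : IsRegularSubset R) {f g : X × Y → Z}
    (hf : ContinuousOn f (R ×ˢ univ)) (hg : ContinuousOn g (R ×ˢ univ))
    (h : ∀ x ∈ interior R, ∀ y, f (x, y) = g (x, y)) : ∀ x ∈ R, ∀ y, f (x, y) = g (x, y) := by
  have : EqOn f g (R ×ˢ univ) := by
    refine Set.EqOn.of_subset_closure (s := interior R ×ˢ univ) ?_ hf hg
      (prod_mono interior_subset subset_rfl) ?_
    · rintro ⟨x, y⟩ ⟨hx, -⟩
      exact h x hx y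
    · rw [closure_prod_eq, closure_univ]
      exact prod_mono hR subset_rfl
  exact fun x hx y => this ⟨hx, mem_univ _⟩

theorem eqOn_of_interior {X Z : Type*} [TopologicalSpace X]
    [TopologicalSpace Z] [T2Space Z]
    {R : Set X} (hR : IsRegularSubset R) {f g : X → Z}
    (hf : ContinuousOn f R) (hg : ContinuousOn g R)
    (h : ∀ x ∈ interior R, f x = g x) : ∀ x ∈ R, f x = g x :=
  Set.EqOn.of_subset_closure (s := interior R) h hf hg interior_subset hR

theorem IsDifferentialOn.continuousOn_dir {R : Set E} {f : E → F} {df : E × E → F}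
    (h : IsDifferentialOn R f df) (v : E) : ContinuousOn (fun x => df (x, v)) R :=
  h.continuousOn.comp (by fun_prop) fun _ hx => ⟨hx, mem_univ _⟩

theorem IsDifferentialOn.map_smul {R : Set E} (hR : IsRegularSubset R) {f : E → F}
    {df : E × E → F} (h : IsDifferentialOn R f df) {x : E} (hx : x ∈ R) (c : ℝ) (v : E) :
    df (x, c • v) = c • df (x, v) :=
  eqOn_of_interior hR (h.continuousOn_dir _) ((h.continuousOn_dir v).const_smul c)
    (fun z hz => (h.hasDirDerivAt z hz _).unique ((h.hasDirDerivAt z hz v).smul_dir c)) x hx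

theorem IsDifferentialOn.map_add [LocallyConvexSpace ℝ F] {R : Set E} (hR : IsRegularSubset R)
    {f : E → F} {df : E × E → F} (h : IsDifferentialOn R f df) {x : E} (hx : x ∈ R) (v w : E) :
    df (x, v + w) = df (x, v) + df (x, w) := by
  refine eqOn_of_interior hR (f := fun x => df (x, v + w)) (h.continuousOn_dir _)
    ((h.continuousOn_dir v).add (h.continuousOn_dir w)) (fun z hz => ?_) x hx
  exact (h.hasDirDerivAt z hz (v + w)).unique (HasDirDerivAt.add_dir (D := fun x => df (x, w))
    isOpen_interior hz ((h.continuousOn_dir w).mono interior_subset)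
    (fun y hy => h.hasDirDerivAt y hy w) (h.hasDirDerivAt z hz v))

/-- A continuous function on an open subset of `ℝ × E` which is differentiable off the hyperplane
`t = b` and whose differential extends continuously to the hyperplane is differentiable. -/
theorem hasDirDerivAt_of_ne [LocallyConvexSpace ℝ F] {U : Set (ℝ × E)} (hU : IsOpen U) {b : ℝ}
    {f : ℝ × E → F} (hf : ContinuousOn f U) {D : ℝ × E → F} {v : ℝ × E} (hD : ContinuousOn D U)
    (hd : ∀ x ∈ U, x.1 ≠ b → HasDirDerivAt f x v (D x)) :
    ∀ x ∈ U, HasDirDerivAt f x v (D x) := by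
  intro x hx
  by_cases hxb : x.1 ≠ b
  · exact hd x hx hxb
  push Not at hxb
  refine tendsto_of_seminorm fun p hp ε hε => ?_
  have hV : ContinuousWithinAt D (U ∩ {z | z.1 ≠ b}) x := (hD x hx).mono inter_subset_left
  have h1 := eventually_diffQuot_near hV (fun z hz => hd z hz.1 hz.2) hp (half_pos hε)
  have hin := eventually_segment (v := v) (P := (· ∈ U)) (hU.mem_nhds hx)
  have h2 := (h1.and hin)
  rw [nhds_prod_eq] at h2
  obtain ⟨P, hP, Q, hQ, hPQ⟩ := Filter.eventually_prod_iff.1 h2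
  filter_upwards [hQ.filter_mono nhdsWithin_le_nhds, self_mem_nhdsWithin] with h hh h0
  refine lt_of_le_of_lt ?_ (half_lt_self hε)
  -- The base point is shifted off the hyperplane by δ σ, to the side into which h • v points
  -- (either side if h • v is parallel to it). The shifted segment then never meets the hyperplane,
  -- and letting δ → 0 uses only continuity of f.
  obtain ⟨σ, hσ0, hσ⟩ : ∃ σ : ℝ, σ ≠ 0 ∧ 0 ≤ σ * (h * v.1) := by
    rcases le_total 0 (h * v.1) with h' | h'
    · exact ⟨1, one_ne_zero, by linarith⟩
    · exact ⟨-1, by norm_num, by linarith⟩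
  let y : ℝ → ℝ × E := fun δ => (x.1 + δ * σ, x.2)
  have hy : Tendsto y (𝓝[>] 0) (𝓝 x) := by
    have : Continuous y := by fun_prop
    simpa [y] using (this.tendsto 0).mono_left nhdsWithin_le_nhds
  have hxh : x + h • v ∈ U := by
    have := (hPQ hP.self_of_nhds hh).2 1 (by simp)
    simpa using this
  have hyh : Tendsto (fun δ => y δ + h • v) (𝓝[>] 0) (𝓝 (x + h • v)) := hy.add_const _
  have ht : Tendsto (fun δ => p (diffQuot f (y δ) v h - D x)) (𝓝[>] 0)
      (𝓝 (p (diffQuot f x v h - D x))) := by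
    refine (hp.tendsto _).comp (Tendsto.sub_const (Tendsto.const_smul ?_ _) _)
    exact (((hf.continuousAt (hU.mem_nhds hxh)).tendsto.comp hyh)).sub
      ((hf.continuousAt (hU.mem_nhds hx)).tendsto.comp hy)
  refine le_of_tendsto ht ?_
  filter_upwards [hy.eventually hP, self_mem_nhdsWithin] with δ hδ hδ0
  obtain ⟨ha, hb⟩ := hPQ hδ hh
  refine ha h0 fun r hr => ⟨hb r hr, ?_⟩
  simp only [mem_ofPred_eq, Prod.fst_add, Prod.smul_fst, smul_eq_mul, y, hxb]
  intro he
  have h3 : δ * σ + r * (h * v.1) = 0 := by linarith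
  have h4 : 0 < δ * (σ * σ) := mul_pos hδ0 (mul_self_pos.2 hσ0)
  have h5 : 0 ≤ r * (σ * (h * v.1)) := mul_nonneg hr.1 hσ
  have : σ * (δ * σ + r * (h * v.1)) = 0 := by rw [h3, mul_zero]
  nlinarith

end Linearity

/-! ### Families tending to zero in the C^n-sense along a filter. -/

section NullFamilies

variable {ι : Type w} {F : Type v} [AddCommGroup F] [Module ℝ F] [TopologicalSpace F]

/-- A family of continuous functions on `R` which tends to zero, uniformly on compact sets, along
the filter `𝓕`. -/
structure IsNullOn (𝓕 : Filter ι) {X : Type*} [TopologicalSpace X] (R : Set X)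
    (f : ι → X → F) : Prop where
  continuousOn : ∀ i, ContinuousOn (f i) R
  eventually_lt : ∀ K ⊆ R, IsCompact K → ∀ p : Seminorm ℝ F, Continuous p → ∀ ε > 0,
    ∀ᶠ i in 𝓕, ∀ x ∈ K, p (f i x) < ε

/-- A family of `C^n`-functions on `R` which tends to zero in the `C^n`-sense along the
filter `𝓕`: the functions and their differentials up to order `n` tend to zero uniformly on compact
sets. -/
def IsCkNullOn {F : Type v} [AddCommGroup F] [Module ℝ F] [TopologicalSpace F] (𝓕 : Filter ι) :
    ℕ → ∀ {E : Type u} [AddCommGroup E] [Module ℝ E] [TopologicalSpace E],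
      Set E → (ι → E → F) → Prop
  | 0, _, _, _, _, R, f => IsNullOn 𝓕 R f
  | n + 1, E, _, _, _, R, f =>
      IsNullOn 𝓕 R f ∧ ∃ df : ι → E × E → F,
        (∀ i, IsDifferentialOn R (f i) (df i)) ∧ IsCkNullOn 𝓕 n (R ×ˢ (univ : Set E)) df

variable {𝓕 : Filter ι}

section Null

variable {X Y : Type*} [TopologicalSpace X] [TopologicalSpace Y]

theorem IsNullOn.congr {R : Set X} {f g : ι → X → F} (hf : IsNullOn 𝓕 R f)
    (h : ∀ i, ∀ x ∈ R, f i x = g i x) : IsNullOn 𝓕 R g := by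
  refine ⟨fun i => (hf.1 i).congr fun x hx => (h i x hx).symm, fun K hK hKc p hp ε hε => ?_⟩
  filter_upwards [hf.2 K hK hKc p hp ε hε] with i hi x hx
  rw [← h i x (hK hx)]
  exact hi x hx

theorem IsNullOn.comp {R : Set X} {R' : Set Y} {f : ι → X → F} (hf : IsNullOn 𝓕 R f)
    {φ : Y → X} (hφ : ContinuousOn φ R') (hm : MapsTo φ R' R) :
    IsNullOn 𝓕 R' fun i y => f i (φ y) := by
  refine ⟨fun i => (hf.1 i).comp hφ hm, fun K hK hKc p hp ε hε => ?_⟩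
  filter_upwards [hf.2 (φ '' K) (hm.mono_left hK).image_subset (hKc.image_of_continuousOn
    (hφ.mono hK)) p hp ε hε] with i hi x hx
  exact hi _ (mem_image_of_mem _ hx)

theorem isNullOn_zero {R : Set X} : IsNullOn 𝓕 R (0 : ι → X → F) :=
  ⟨fun _ => continuousOn_const, fun K _ _ p _ ε hε => Eventually.of_forall fun i x _ => by
    simpa using hε⟩

variable [IsTopologicalAddGroup F] [ContinuousSMul ℝ F]

theorem IsNullOn.add {R : Set X} {f g : ι → X → F} (hf : IsNullOn 𝓕 R f)
    (hg : IsNullOn 𝓕 R g) : IsNullOn 𝓕 R (f + g) := by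
  refine ⟨fun i => (hf.1 i).add (hg.1 i), fun K hK hKc p hp ε hε => ?_⟩
  filter_upwards [hf.2 K hK hKc p hp _ (half_pos hε), hg.2 K hK hKc p hp _ (half_pos hε)]
    with i hi hi' x hx
  refine (map_add_le_add p _ _).trans_lt ?_
  linarith [hi x hx, hi' x hx]

theorem IsNullOn.smul {R : Set X} {f : ι → X → F} (hf : IsNullOn 𝓕 R f) {c : X → ℝ}
    (hc : ContinuousOn c R) : IsNullOn 𝓕 R fun i x => c x • f i x := by
  refine ⟨fun i => hc.smul (hf.1 i), fun K hK hKc p hp ε hε => ?_⟩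
  obtain ⟨C, hC⟩ := hKc.exists_bound_of_continuousOn (hc.mono hK)
  have hC' : 0 < |C| + 1 := by positivity
  filter_upwards [hf.2 K hK hKc p hp _ (div_pos hε hC')] with i hi x hx
  rw [map_smul_eq_mul]
  have h1 := hi x hx
  rw [lt_div_iff₀ hC'] at h1
  have h2 := (hC x hx).trans (le_abs_self C)
  nlinarith [apply_nonneg p (f i x)]

end Null

variable {E : Type u} [AddCommGroup E] [Module ℝ E] [TopologicalSpace E]

theorem IsCkNullOn.isNullOn {n : ℕ} {R : Set E} {f : ι → E → F} (h : IsCkNullOn 𝓕 n R f) :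
    IsNullOn 𝓕 R f := by
  cases n with
  | zero => exact h
  | succ n => exact h.1

theorem IsCkNullOn.of_succ (n : ℕ) : ∀ {E : Type u} [AddCommGroup E] [Module ℝ E]
    [TopologicalSpace E] {R : Set E} {f : ι → E → F},
    IsCkNullOn 𝓕 (n + 1) R f → IsCkNullOn 𝓕 n R f := by
  induction n with
  | zero => intro E _ _ _ R f h; exact h.1
  | succ n ih =>
    rintro E _ _ _ R f ⟨h, df, hdf, h'⟩
    exact ⟨h, df, hdf, ih h'⟩

theorem IsCkNullOn.isCkOn (n : ℕ) : ∀ {E : Type u} [AddCommGroup E] [Module ℝ E]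
    [TopologicalSpace E] {R : Set E} {f : ι → E → F},
    IsCkNullOn 𝓕 n R f → ∀ i, IsCkOn n R (f i) := by
  induction n with
  | zero => intro E _ _ _ R f h i; exact h.1 i
  | succ n ih =>
    rintro E _ _ _ R f ⟨h, df, hdf, h'⟩ i
    exact ⟨h.1 i, df i, hdf i, ih h' i⟩

/-- Along ⊥ the smallness conditions are vacuous. With `IsCkNullOn.isCkOn`, every stability result
for null families thus contains the one for C^n-maps. -/
theorem IsCkOn.isCkNullOn_bot (n : ℕ) : ∀ {E : Type u} [AddCommGroup E] [Module ℝ E]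
    [TopologicalSpace E] {R : Set E} {f : ι → E → F},
    (∀ i, IsCkOn n R (f i)) → IsCkNullOn (⊥ : Filter ι) n R f := by
  induction n with
  | zero => intro E _ _ _ R f h; exact ⟨h, by simp⟩
  | succ n ih =>
    intro E _ _ _ R f h
    choose h1 df hdf h2 using h
    exact ⟨⟨h1, by simp⟩, df, hdf, ih h2⟩

theorem isCkNullOn_zero (n : ℕ) : ∀ {E : Type u} [AddCommGroup E] [Module ℝ E]
    [TopologicalSpace E] {R : Set E}, IsCkNullOn 𝓕 n R (0 : ι → E → F) := by
  induction n with
  | zero => intro E _ _ _ R; exact isNullOn_zero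
  | succ n ih =>
    intro E _ _ _ R
    refine ⟨isNullOn_zero, 0, fun i => ⟨continuousOn_const, fun x _ v => ?_⟩, ih⟩
    refine tendsto_const_nhds.congr fun t => ?_
    simp [diffQuot]

theorem IsCkNullOn.add [IsTopologicalAddGroup F] [ContinuousSMul ℝ F] (n : ℕ) :
    ∀ {E : Type u} [AddCommGroup E] [Module ℝ E]
    [TopologicalSpace E] {R : Set E} {f g : ι → E → F},
    IsCkNullOn 𝓕 n R f → IsCkNullOn 𝓕 n R g → IsCkNullOn 𝓕 n R (f + g) := by
  induction n with
  | zero => intro E _ _ _ R f g hf hg; exact IsNullOn.add hf hg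
  | succ n ih =>
    rintro E _ _ _ R f g ⟨hf, df, hdf, hf'⟩ ⟨hg, dg, hdg, hg'⟩
    exact ⟨hf.add hg, df + dg, fun i => ⟨(hdf i).1.add (hdg i).1,
      fun x hx v => ((hdf i).2 x hx v).add ((hdg i).2 x hx v)⟩, ih hf' hg'⟩

theorem IsCkNullOn.sum [IsTopologicalAddGroup F] [ContinuousSMul ℝ F] {n : ℕ} {R : Set E}
    {κ : Type*} {s : Finset κ} {f : κ → ι → E → F} (h : ∀ k ∈ s, IsCkNullOn 𝓕 n R (f k)) :
    IsCkNullOn 𝓕 n R (∑ k ∈ s, f k) := by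
  classical
  induction s using Finset.induction_on with
  | empty => simpa using isCkNullOn_zero n
  | insert a s ha ih =>
    rw [Finset.sum_insert ha]
    exact (h a (Finset.mem_insert_self a s)).add n
      (ih fun k hk => h k (Finset.mem_insert_of_mem hk))

theorem IsDifferentialOn.congr [ContinuousSMul ℝ E] [IsTopologicalAddGroup E]
    {R : Set E} {f g : E → F}
    {df : E × E → F} (hf : IsDifferentialOn R f df) (h : ∀ x ∈ R, f x = g x) :
    IsDifferentialOn R g df := by
  refine ⟨hf.1, fun x hx v => (hf.2 x hx v).congr_of_eventuallyEq ?_⟩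
  filter_upwards [isOpen_interior.mem_nhds hx] with z hz using h z (interior_subset hz)

theorem IsCkNullOn.congr [IsTopologicalAddGroup E] [ContinuousSMul ℝ E] {n : ℕ} {R : Set E}
    {f g : ι → E → F} (hf : IsCkNullOn 𝓕 n R f) (h : ∀ i, ∀ x ∈ R, f i x = g i x) :
    IsCkNullOn 𝓕 n R g := by
  cases n with
  | zero => exact IsNullOn.congr hf h
  | succ n =>
    obtain ⟨hf, df, hdf, hf'⟩ := hf
    exact ⟨hf.congr h, df, fun i => (hdf i).congr (h i), hf'⟩

/-- The differential is again a composition with an affine map, with linear part L × L, so the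
induction closes. Interiors need their own condition: L need not be open, and directional
derivatives are given only at interior points of R. -/
theorem IsCkNullOn.comp_affine [IsTopologicalAddGroup F] (n : ℕ) :
    ∀ {E E' : Type u} [AddCommGroup E] [Module ℝ E] [TopologicalSpace E]
    [IsTopologicalAddGroup E] [ContinuousSMul ℝ E] [AddCommGroup E'] [Module ℝ E'] [TopologicalSpace E']
    [IsTopologicalAddGroup E'] [ContinuousSMul ℝ E']
    {R : Set E} {R' : Set E'} {f : ι → E → F} (L : E' →L[ℝ] E) (c : E),
    IsCkNullOn 𝓕 n R f → MapsTo (fun x => L x + c) R' R →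
    MapsTo (fun x => L x + c) (interior R') (interior R) →
    IsCkNullOn 𝓕 n R' fun i x => f i (L x + c) := by
  induction n with
  | zero =>
    intro E E' _ _ _ _ _ _ _ _ _ _ R R' f L c hf hm _
    exact IsNullOn.comp hf (by fun_prop) hm
  | succ n ih =>
    rintro E E' _ _ _ _ _ _ _ _ _ _ R R' f L c ⟨hf, df, hdf, hf'⟩ hm hi
    refine ⟨hf.comp (by fun_prop) hm, fun i p => df i (L p.1 + c, L p.2), fun i => ⟨?_, ?_⟩, ?_⟩
    · exact (hdf i).1.comp (by fun_prop) fun p hp => ⟨hm hp.1, mem_univ _⟩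
    · intro x hx v
      exact HasDirDerivAt.comp_affine (L := (L : E' →ₗ[ℝ] E)) ((hdf i).2 _ (hi hx) (L v))
    · refine (ih (R' := R' ×ˢ univ) (L.prodMap L) ((c, 0) : E × E) hf' ?_ ?_).congr ?_
      · exact fun p hp => ⟨hm hp.1, mem_univ _⟩
      · intro p hp
        rw [interior_prod_eq, interior_univ] at hp ⊢
        exact ⟨hi hp.1, mem_univ _⟩
      · intro i p _
        simp [Prod.map]

theorem IsCkNullOn.comp_linear [IsTopologicalAddGroup F] {n : ℕ}
    {E E' : Type u} [AddCommGroup E] [Module ℝ E] [TopologicalSpace E]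
    [IsTopologicalAddGroup E] [ContinuousSMul ℝ E] [AddCommGroup E'] [Module ℝ E'] [TopologicalSpace E']
    [IsTopologicalAddGroup E'] [ContinuousSMul ℝ E']
    {R : Set E} {R' : Set E'} {f : ι → E → F} (L : E' →L[ℝ] E)
    (hf : IsCkNullOn 𝓕 n R f) (hm : MapsTo L R' R) (hi : MapsTo L (interior R') (interior R)) :
    IsCkNullOn 𝓕 n R' fun i x => f i (L x) := by
  have := hf.comp_affine n L 0 (R' := R') (by simpa using hm) (by simpa using hi)
  simpa using this

theorem mapsTo_fst_interior_prod_univ {X Y : Type*} [TopologicalSpace X] [TopologicalSpace Y]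
    {R : Set X} : MapsTo Prod.fst (interior (R ×ˢ (univ : Set Y))) (interior R) := by
  intro p hp
  rw [interior_prod_eq] at hp
  exact hp.1

/-- The differential s(v) f(x) + s(x) df(x, v) has the same shape one order lower. Linear factors
suffice: they will be the factors `p.2.1` in `seeleyDiff`. -/
theorem IsCkNullOn.smul [IsTopologicalAddGroup F] [ContinuousSMul ℝ F] (n : ℕ) :
    ∀ {E : Type u} [AddCommGroup E] [Module ℝ E] [TopologicalSpace E]
    [IsTopologicalAddGroup E] [ContinuousSMul ℝ E]
    {R : Set E} {f : ι → E → F} (s : E →L[ℝ] ℝ),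
    IsCkNullOn 𝓕 n R f → IsCkNullOn 𝓕 n R fun i x => s x • f i x := by
  induction n with
  | zero =>
    intro E _ _ _ _ _ R f s hf
    exact IsNullOn.smul hf (by fun_prop)
  | succ n ih =>
    rintro E _ _ _ _ _ R f s hf
    have hf0 := hf.of_succ n
    obtain ⟨hf, df, hdf, hf'⟩ := hf
    refine ⟨hf.smul (by fun_prop), fun i p => s p.2 • f i p.1 + s p.1 • df i p, fun i => ⟨?_, ?_⟩,
      ?_⟩
    · refine ContinuousOn.add (ContinuousOn.smul (by fun_prop) ?_)
        (ContinuousOn.smul (by fun_prop) (hdf i).1)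
      exact (hf.1 i).comp (by fun_prop) fun p hp => hp.1
    · intro x hx v
      refine HasDirDerivAt.smul ?_ ((hdf i).2 x hx v)
      refine tendsto_const_nhds.congr' ?_
      filter_upwards [self_mem_nhdsWithin] with t ht
      have ht' : t ≠ 0 := ht
      simp [diffQuot, ht']
    · refine IsCkNullOn.add n ?_ (ih (s.comp (ContinuousLinearMap.fst ℝ E E)) hf')
      exact ih (s.comp (ContinuousLinearMap.snd ℝ E E)) (hf0.comp_linear
        (ContinuousLinearMap.fst ℝ E E) (fun p hp => hp.1) mapsTo_fst_interior_prod_univ)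

end NullFamilies

/-! ### Seeley operators -/

/-- A smooth function which vanishes on `]-∞, τ]` and is constant near `b`. -/
structure IsPlateau (τ b : ℝ) (σ : ℝ → ℝ) : Prop where
  contDiff : ContDiff ℝ (⊤ : ℕ∞) σ
  eq_zero : ∀ t ≤ τ, σ t = 0
  eventually_eq : ∀ᶠ t in 𝓝 b, σ t = σ b

theorem IsCutoff.isPlateau {τ b : ℝ} {ρ : ℝ → ℝ} (h : IsCutoff τ b ρ) : IsPlateau τ b ρ :=
  ⟨h.1, h.2, by filter_upwards [h.3] with t ht; rw [ht, h.3.self_of_nhds]⟩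

theorem IsPlateau.hasDerivAt {τ b : ℝ} {σ : ℝ → ℝ} (h : IsPlateau τ b σ) (t : ℝ) :
    HasDerivAt σ (deriv σ t) t :=
  (h.1.differentiable (by simp) t).hasDerivAt

theorem IsPlateau.deriv_eq_zero {τ b : ℝ} {σ : ℝ → ℝ} (h : IsPlateau τ b σ) : deriv σ b = 0 := by
  have h1 : σ =ᶠ[𝓝 b] fun _ => σ b := h.3
  rw [h1.deriv_eq, deriv_const]

/-- Closure under differentiation is the reason for allowing any constant near b: the derivative of
a cut-off has the value 0 at b, not 1. Constancy on a whole neighbourhood of b is what makes the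
property hereditary. -/
theorem IsPlateau.deriv {τ b : ℝ} {σ : ℝ → ℝ} (h : IsPlateau τ b σ) :
    IsPlateau τ b (deriv σ) := by
  have h1 : ContDiff ℝ (⊤ : ℕ∞) (_root_.deriv σ) := (contDiff_infty_iff_deriv.1 h.1).2
  refine ⟨h1, fun t ht => ?_, ?_⟩
  · have h2 : EqOn (_root_.deriv σ) (fun _ => 0) (closure (Iio τ)) := by
      refine Set.EqOn.closure (fun s hs => ?_) h1.continuous continuous_const
      have h3 : σ =ᶠ[𝓝 s] fun _ => (0 : ℝ) := by
        filter_upwards [gt_mem_nhds (show s < τ from hs)] with r hr using h.2 r (le_of_lt hr)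
      rw [h3.deriv_eq, deriv_const]
    rw [closure_Iio] at h2
    exact h2 ht
  · filter_upwards [h.3.eventually_nhds] with t ht
    have h3 : σ =ᶠ[𝓝 t] fun _ => σ b := ht
    rw [h3.deriv_eq, deriv_const, h.deriv_eq_zero]

theorem IsPlateau.exists_bound {τ b : ℝ} {σ : ℝ → ℝ} (h : IsPlateau τ b σ) :
    ∃ C, 0 ≤ C ∧ ∀ t ≤ b, |σ t| ≤ C := by
  obtain ⟨C, hC⟩ := (isCompact_Icc (a := τ) (b := b)).exists_bound_of_continuousOn
    h.1.continuous.continuousOn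
  refine ⟨|C|, abs_nonneg _, fun t ht => ?_⟩
  rcases le_total t τ with h' | h'
  · rw [h.2 t h', abs_zero]; positivity
  · exact (hC t ⟨h', ht⟩).trans (le_abs_self C)

theorem SeeleySequence.summable_abs (S : SeeleySequence) (i : ℕ) :
    Summable fun k => |S.c k * S.m k ^ i| := by
  simpa only [abs_mul, abs_pow] using S.summable i

theorem SeeleySequence.reflect_le (S : SeeleySequence) {b t : ℝ} (h : b ≤ t) (k : ℕ) :
    b + S.m k * (t - b) ≤ b := by
  nlinarith [S.m_neg k]

theorem SeeleySequence.reflect_lt (S : SeeleySequence) {b t : ℝ} (h : b < t) (k : ℕ) :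
    b + S.m k * (t - b) < b := by
  nlinarith [S.m_neg k]

/-- This is the local finiteness of the sum on t > b, uniform for t ≥ t₀ because m_k → -∞.
Uniformity is not available up to t = b, where a limit argument is needed instead. -/
theorem SeeleySequence.exists_forall_reflect_le (S : SeeleySequence) {b t₀ : ℝ} (h : b < t₀)
    (τ : ℝ) : ∃ N : ℕ, ∀ k ≥ N, ∀ t ≥ t₀, b + S.m k * (t - b) ≤ τ := by
  obtain ⟨N, hN⟩ := eventually_atTop.1 (S.m_tendsto.eventually_le_atBot ((τ - b) / (t₀ - b)))
  refine ⟨N, fun k hk t ht => ?_⟩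
  have h1 := hN k hk
  rw [le_div_iff₀ (by linarith)] at h1
  nlinarith [S.m_neg k]

noncomputable section

variable {E : Type u} {F : Type v} [AddCommGroup F] [Module ℝ F]

/-- The extension of `σ b • f` from `t ≤ b` to all `t` by the weighted sum of reflections
`∑ c k * m k ^ i * σ (b + m k (t - b)) • f (b + m k (t - b), x)`. -/
def seeleyOp (S : SeeleySequence) (b : ℝ) (i : ℕ) (σ : ℝ → ℝ) (f : ℝ × E → F) : ℝ × E → F :=
  fun p => open Classical in
    if p.1 ≤ b then σ b • f p
    else ∑ᶠ k : ℕ, (S.c k * S.m k ^ i * σ (b + S.m k * (p.1 - b))) •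
      f (b + S.m k * (p.1 - b), p.2)

theorem seeleyOp_of_le (S : SeeleySequence) {b : ℝ} (i : ℕ) (σ : ℝ → ℝ) (f : ℝ × E → F)
    {p : ℝ × E} (h : p.1 ≤ b) : seeleyOp S b i σ f p = σ b • f p :=
  if_pos h

theorem seeleyOp_eq_sum {S : SeeleySequence} {τ b : ℝ} (i : ℕ) {σ : ℝ → ℝ}
    (hσ : ∀ t ≤ τ, σ t = 0) (f : ℝ × E → F) {p : ℝ × E} (h : b < p.1) {N : ℕ}
    (hN : ∀ k ≥ N, b + S.m k * (p.1 - b) ≤ τ) :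
    seeleyOp S b i σ f p = ∑ k ∈ Finset.range N, (S.c k * S.m k ^ i) •
      (σ (b + S.m k * (p.1 - b)) • f (b + S.m k * (p.1 - b), p.2)) := by
  rw [seeleyOp, if_neg h.not_ge, finsum_eq_sum_of_support_subset (s := Finset.range N)]
  · simp only [smul_smul]
  · intro k hk
    by_contra hk'
    simp only [Finset.coe_range, mem_Iio, not_lt] at hk'
    exact hk (by simp [hσ _ (hN k hk')])

end

/-! ### Order zero: continuity and seminorm estimates for the reflected sums. -/

section Topological

variable {E : Type u} [TopologicalSpace E]
variable {F : Type v} [AddCommGroup F] [Module ℝ F] [TopologicalSpace F]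
  [IsTopologicalAddGroup F] [ContinuousSMul ℝ F]

/-- Since σ vanishes up to τ > a, the product continues by zero past a. Reflected points that leave
]a, b] therefore do no harm. -/
theorem continuousOn_plateau_smul {a : EReal} {τ b : ℝ} (haτ : a < (τ : EReal)) {σ : ℝ → ℝ}
    (hσ : IsPlateau τ b σ) {R : Set E} {f : ℝ × E → F} (hf : ContinuousOn f (leftDomain a b R)) :
    ContinuousOn (fun p : ℝ × E => σ p.1 • f p) (Iic b ×ˢ R) := by
  have hσc := hσ.1.continuous
  intro p hp
  rcases lt_or_ge p.1 τ with h | h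
  · have h1 : (fun p : ℝ × E => σ p.1 • f p) =ᶠ[𝓝[Iic b ×ˢ R] p] fun _ => (0 : F) := by
      refine Filter.Eventually.filter_mono nhdsWithin_le_nhds ?_
      filter_upwards [continuous_fst.continuousAt.eventually (gt_mem_nhds h)] with q hq
      rw [hσ.2 _ hq.le, zero_smul]
    exact continuousWithinAt_const.congr_of_eventuallyEq h1 (by rw [hσ.2 _ h.le, zero_smul])
  · have hap : a < (p.1 : EReal) := haτ.trans_le (EReal.coe_le_coe_iff.2 h)
    have h1 : ContinuousWithinAt (fun p : ℝ × E => σ p.1 • f p) (leftDomain a b R) p :=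
      (hσc.comp continuous_fst).continuousWithinAt.smul (hf p ⟨⟨hap, hp.1⟩, hp.2⟩)
    refine h1.mono_of_mem_nhdsWithin ?_
    have h2 : {q : ℝ × E | a < (q.1 : EReal)} ∈ 𝓝[Iic b ×ˢ R] p :=
      nhdsWithin_le_nhds (((isOpen_coe_gt a).preimage continuous_fst).mem_nhds hap)
    filter_upwards [h2, self_mem_nhdsWithin] with q hq hq'
    exact ⟨⟨hq, hq'.1⟩, hq'.2⟩

/-- Write z as ∑ a_k z and use the triangle inequality termwise. As F need not be complete, no
infinite sum of general vectors is formed: the u_k vanish from N on, and only the scalar partial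
sums of a_k pass to the limit. -/
theorem seminorm_sum_sub_le {a : ℕ → ℝ} (ha : HasSum a 1) {z : F} {u : ℕ → F} {N : ℕ}
    (hu : ∀ k ≥ N, u k = 0) {p : Seminorm ℝ F} (hp : Continuous p)
    (hs : Summable fun k => |a k| * p (u k - z)) :
    p (∑ k ∈ Finset.range N, a k • u k - z) ≤ ∑' k, |a k| * p (u k - z) := by
  have h1 : Tendsto (fun n => p (∑ k ∈ Finset.range N, a k • u k -
      (∑ k ∈ Finset.range n, a k) • z)) atTop
      (𝓝 (p (∑ k ∈ Finset.range N, a k • u k - (1 : ℝ) • z))) :=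
    (hp.tendsto _).comp (tendsto_const_nhds.sub (ha.tendsto_sum_nat.smul_const z))
  rw [one_smul] at h1
  refine le_of_tendsto h1 ?_
  filter_upwards [eventually_ge_atTop N] with n hn
  have h2 : ∑ k ∈ Finset.range N, a k • u k = ∑ k ∈ Finset.range n, a k • u k := by
    refine Finset.sum_subset (Finset.range_mono hn) fun k _ hk => ?_
    simp only [Finset.mem_range, not_lt] at hk
    rw [hu k hk, smul_zero]
  rw [h2, Finset.sum_smul, ← Finset.sum_sub_distrib]
  refine (Finset.le_sum_of_subadditive p (map_zero p).le (map_add_le_add p) _ _).trans (le_trans (Finset.sum_le_sum fun k _ => ?_)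
    (hs.sum_le_tsum (Finset.range n) fun k _ => by positivity))
  rw [← smul_sub, map_smul_eq_mul, Real.norm_eq_abs]

/-- The reflected sums converge at `t = b`. -/
theorem tendsto_seeleyOp [LocallyConvexSpace ℝ F] (S : SeeleySequence) {a : EReal} {τ b : ℝ}
    (haτ : a < (τ : EReal)) (i : ℕ) {σ : ℝ → ℝ}
    (hσ : IsPlateau τ b σ) {R : Set E} {f : ℝ × E → F} (hf : ContinuousOn f (leftDomain a b R))
    {x₀ : E} (hx₀ : x₀ ∈ R) :
    Tendsto (seeleyOp S b i σ f) (𝓝[Ioi b ×ˢ R] (b, x₀)) (𝓝 (σ b • f (b, x₀))) := by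
  have hh := continuousOn_plateau_smul haτ hσ hf
  set h : ℝ × E → F := fun p => σ p.1 • f p with hdef
  refine tendsto_of_seminorm fun p hp ε hε => ?_
  have hph : ContinuousOn (fun q => p (h q)) (Iic b ×ˢ R) := hp.comp_continuousOn hh
  -- A bound on p ∘ h for all r ≤ b and all x ∈ R near x₀: compactness of [τ, b] gives it there, and
  -- h = 0 below τ.
  obtain ⟨C, hC⟩ : ∃ C, ∀ᶠ x in 𝓝 x₀, x ∈ R → ∀ r ≤ b, p (h (r, x)) ≤ C := by
    obtain ⟨M, hM⟩ := (isCompact_Icc (a := τ) (b := b)).exists_bound_of_continuousOn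
      (f := fun r => p (h (r, x₀))) (hph.comp (by fun_prop) fun r hr => ⟨hr.2, hx₀⟩)
    refine ⟨|M| + 1, ?_⟩
    have h1 : ∀ᶠ x in 𝓝 x₀, ∀ r ∈ Icc τ b, x ∈ R → r ≤ b → p (h (r, x)) < |M| + 1 := by
      refine isCompact_Icc.eventually_forall_of_forall_eventually fun r hr => ?_
      have h2 : p (h (r, x₀)) < |M| + 1 := by
        have := (le_abs_self _).trans (hM r hr)
        linarith [le_abs_self M]
      have h3 := (hph (r, x₀) ⟨hr.2, hx₀⟩).eventually (gt_mem_nhds h2)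
      have h4 := eventually_nhdsWithin_iff.1 h3
      have h5 : Tendsto (fun q : E × ℝ => (q.2, q.1)) (𝓝 (x₀, r)) (𝓝 (r, x₀)) :=
        continuous_swap.tendsto _
      filter_upwards [h5.eventually h4] with q hq hq1 hq2
      exact hq ⟨hq2, hq1⟩
    filter_upwards [h1] with x hx hxR r hr
    rcases le_total r τ with h' | h'
    · simp only [hdef, hσ.2 r h', zero_smul, map_zero]; positivity
    · exact (hx r ⟨h', hr⟩ hxR hr).le
  set A : ℕ → ℝ := fun k => S.c k * S.m k ^ i with hA
  set r : ℕ → ℝ × E → ℝ × E := fun k q => (b + S.m k * (q.1 - b), q.2) with hr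
  have hrc : ∀ k, Continuous (r k) := fun k => by fun_prop
  have hC' : ∀ᶠ q in 𝓝[Ioi b ×ˢ R] (b, x₀), ∀ k, p (h (r k q) - h (b, x₀)) ≤
      C + p (h (b, x₀)) := by
    have h1 : Tendsto (fun q : ℝ × E => q.2) (𝓝[Ioi b ×ˢ R] (b, x₀)) (𝓝 x₀) :=
      (continuous_snd.tendsto (b, x₀)).mono_left nhdsWithin_le_nhds
    filter_upwards [h1.eventually hC, self_mem_nhdsWithin] with q hq hq' k
    exact (map_sub_le_add p _ _).trans
      (add_le_add_left (hq hq'.2 _ (S.reflect_le (le_of_lt hq'.1) k)) _)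
  have hsum : Summable fun k => |A k| * (C + p (h (b, x₀))) := (S.summable_abs i).mul_right _
  -- Dominated convergence in k: for fixed k the reflected point tends to (b, x₀), and |A k| (C + p
  -- (h (b, x₀))) is a summable majorant independent of q.
  have hlim : Tendsto (fun q => ∑' k, |A k| * p (h (r k q) - h (b, x₀)))
      (𝓝[Ioi b ×ˢ R] (b, x₀)) (𝓝 (∑' k : ℕ, (0 : ℝ))) := by
    refine tendsto_tsum_of_dominated_convergence hsum (fun k => ?_) ?_
    · have h1 : Tendsto (r k) (𝓝[Ioi b ×ˢ R] (b, x₀)) (𝓝[Iic b ×ˢ R] (b, x₀)) := by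
        refine tendsto_nhdsWithin_of_tendsto_nhds_of_eventually_within _ ?_ ?_
        · have := (hrc k).tendsto (b, x₀)
          simp only [hr, sub_self, mul_zero, add_zero] at this
          exact this.mono_left nhdsWithin_le_nhds
        · filter_upwards [self_mem_nhdsWithin] with q hq
          exact ⟨S.reflect_le (le_of_lt hq.1) k, hq.2⟩
      have h2 : Tendsto (fun q => h (r k q)) (𝓝[Ioi b ×ˢ R] (b, x₀)) (𝓝 (h (b, x₀))) :=
        (hh (b, x₀) ⟨le_refl b, hx₀⟩).tendsto.comp h1
      have h3 := ((hp.tendsto _).comp (h2.sub_const (h (b, x₀)))).const_mul |A k|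
      simpa using h3
    · filter_upwards [hC'] with q hq k
      rw [Real.norm_of_nonneg (by positivity)]
      exact mul_le_mul_of_nonneg_left (hq k) (abs_nonneg _)
  rw [tsum_zero] at hlim
  filter_upwards [hlim.eventually (gt_mem_nhds hε), hC', self_mem_nhdsWithin] with q hq hqC hqm
  refine lt_of_le_of_lt ?_ hq
  obtain ⟨N, hN⟩ := S.exists_forall_reflect_le hqm.1 τ
  rw [seeleyOp_eq_sum i hσ.2 f hqm.1 fun k hk => hN k hk _ le_rfl]
  refine seminorm_sum_sub_le (a := A) (u := fun k => h (r k q)) (S.hasSum_moment i)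
    (fun k hk => ?_) hp ?_
  · simp only [hdef, hr, hσ.2 _ (hN k hk _ le_rfl), zero_smul]
  · exact Summable.of_nonneg_of_le (fun k => by positivity)
      (fun k => mul_le_mul_of_nonneg_left (hqC k) (abs_nonneg _)) hsum

theorem eventually_seeleyOp_eq_sum (S : SeeleySequence) {τ b : ℝ} {σ : ℝ → ℝ}
    (hσ : ∀ t ≤ τ, σ t = 0) {p : ℝ × E} (h : b < p.1) :
    ∃ N : ℕ, (∀ k ≥ N, b + S.m k * (p.1 - b) ≤ τ) ∧ ∀ (i : ℕ) (f : ℝ × E → F), ∀ᶠ q in 𝓝 p,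
      seeleyOp S b i σ f q = ∑ k ∈ Finset.range N, (S.c k * S.m k ^ i) •
      (σ (b + S.m k * (q.1 - b)) • f (b + S.m k * (q.1 - b), q.2)) := by
  -- Starting from the midpoint between b and p.1 makes the same N valid near p.
  obtain ⟨N, hN⟩ := S.exists_forall_reflect_le (show b < (p.1 + b) / 2 by linarith) τ
  refine ⟨N, fun k hk => hN k hk _ (by linarith), fun i f => ?_⟩
  filter_upwards [continuous_fst.continuousAt.eventually
    (lt_mem_nhds (show (p.1 + b) / 2 < p.1 by linarith))] with q hq
  exact seeleyOp_eq_sum i hσ f (by linarith) fun k hk => hN k hk _ hq.le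

theorem continuousOn_seeleyOp [LocallyConvexSpace ℝ F] (S : SeeleySequence) {a : EReal} {τ b : ℝ}
    (haτ : a < (τ : EReal)) (i : ℕ) {σ : ℝ → ℝ}
    (hσ : IsPlateau τ b σ) {R : Set E} {f : ℝ × E → F} (hf : ContinuousOn f (leftDomain a b R)) :
    ContinuousOn (seeleyOp S b i σ f) (rightDomain a R) := by
  have hsub : rightDomain a R ⊆ leftDomain a b R ∪ Ioi b ×ˢ R := by
    intro p hp
    rcases le_or_gt p.1 b with h | h
    · exact Or.inl ⟨⟨hp.1, h⟩, hp.2⟩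
    · exact Or.inr ⟨h, hp.2⟩
  intro p hp
  rcases lt_or_ge b p.1 with h | h
  · obtain ⟨N, -, hN⟩ := eventually_seeleyOp_eq_sum (F := F) S hσ.2 h
    refine ContinuousWithinAt.congr_of_eventuallyEq ?_ ((hN i f).filter_mono nhdsWithin_le_nhds)
      (hN i f).self_of_nhds
    refine ContinuousWithinAt.mono_of_mem_nhdsWithin (t := Ioi b ×ˢ R) ?_ ?_
    · refine ContinuousWithinAt.congr (f := fun q => ∑ k ∈ Finset.range N, (S.c k * S.m k ^ i) •
        (σ (b + S.m k * (q.1 - b)) • f (b + S.m k * (q.1 - b), q.2))) ?_ (fun _ _ => rfl) rfl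
      have : ContinuousOn (fun q : ℝ × E => ∑ k ∈ Finset.range N, (S.c k * S.m k ^ i) •
          (σ (b + S.m k * (q.1 - b)) • f (b + S.m k * (q.1 - b), q.2))) (Ioi b ×ˢ R) := by
        refine continuousOn_finsetSum _ fun k _ => ContinuousOn.const_smul ?_ _
        exact (continuousOn_plateau_smul haτ hσ hf).comp
          (f := fun q : ℝ × E => (b + S.m k * (q.1 - b), q.2)) (by fun_prop)
          fun q hq => ⟨S.reflect_le (le_of_lt hq.1) k, hq.2⟩
      exact this p ⟨h, hp.2⟩
    · have h2 : {q : ℝ × E | b < q.1} ∈ 𝓝[rightDomain a R] p :=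
        nhdsWithin_le_nhds ((isOpen_Ioi.preimage continuous_fst).mem_nhds h)
      filter_upwards [h2, self_mem_nhdsWithin] with q hq hq'
      exact ⟨hq, hq'.2⟩
  · refine ContinuousWithinAt.mono ?_ hsub
    have h1 : ContinuousWithinAt (seeleyOp S b i σ f) (leftDomain a b R) p :=
      ((hf p ⟨⟨hp.1, h⟩, hp.2⟩).const_smul (σ b)).congr
        (fun q hq => seeleyOp_of_le S i σ f hq.1.2) (seeleyOp_of_le S i σ f h)
    -- Only the part t > b is left. It is invisible from points with t < b, and at t = b the claim
    -- is `tendsto_seeleyOp`.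
    refine h1.union ?_
    rcases h.lt_or_eq with h' | h'
    · have : ¬ (p ∈ closure (Ioi b ×ˢ R)) := by
        rw [closure_prod_eq, closure_Ioi]
        exact fun hc => h'.not_ge hc.1
      exact continuousWithinAt_of_notMem_closure this
    · obtain ⟨t, x⟩ := p
      simp only at h'
      subst h'
      have := tendsto_seeleyOp S haτ i hσ hf hp.2
      rw [ContinuousWithinAt, seeleyOp_of_le S i σ f (show (t, x).1 ≤ t from le_rfl)]
      exact this

variable {ι : Type w} {𝓕 : Filter ι}

/-- On a compact K the extension sees f only on two compact sets, K ∩ {t ≤ b} and [τ, b] × pr₂(K),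
because σ kills all reflected points below τ. -/
theorem IsNullOn.seeleyOp [LocallyConvexSpace ℝ F] (S : SeeleySequence) {a : EReal} {τ b : ℝ}
    (haτ : a < (τ : EReal)) (i : ℕ) {σ : ℝ → ℝ}
    (hσ : IsPlateau τ b σ) {R : Set E} {f : ι → ℝ × E → F} (hf : IsNullOn 𝓕 (leftDomain a b R) f) :
    IsNullOn 𝓕 (rightDomain a R) fun j => seeleyOp S b i σ (f j) := by
  refine ⟨fun j => continuousOn_seeleyOp S haτ i hσ (hf.1 j), fun K hK hKc p hp ε hε => ?_⟩
  obtain ⟨C, hC0, hC⟩ := hσ.exists_bound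
  set B := ∑' k, |S.c k * S.m k ^ i| with hB
  have hB0 : 0 ≤ B := tsum_nonneg fun k => abs_nonneg _
  -- C controls the part t ≤ b and B C the reflected sum; the summand 1 permits division and makes
  -- the final inequality strict.
  have hA : 0 < C + B * C + 1 := by positivity
  have h1 := hf.2 (K ∩ {q | q.1 ≤ b}) (fun q hq => ⟨⟨(hK hq.1).1, hq.2⟩, (hK hq.1).2⟩)
    (hKc.inter_right (isClosed_Iic.preimage continuous_fst)) p hp _ (div_pos hε hA)
  have h2 := hf.2 (Icc τ b ×ˢ (Prod.snd '' K))
    (by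
      rintro ⟨t, x⟩ ⟨ht, ⟨q, hq, rfl⟩⟩
      exact ⟨⟨haτ.trans_le (EReal.coe_le_coe_iff.2 ht.1), ht.2⟩, (hK hq).2⟩)
    (isCompact_Icc.prod (hKc.image continuous_snd)) p hp _ (div_pos hε hA)
  filter_upwards [h1, h2] with j hj1 hj2 q hq
  have hε' : (C + B * C) * (ε / (C + B * C + 1)) < ε := by
    rw [mul_div_assoc', div_lt_iff₀ hA]
    nlinarith
  have hd : 0 < ε / (C + B * C + 1) := div_pos hε hA
  refine lt_of_le_of_lt ?_ hε'
  rcases le_or_gt q.1 b with h | h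
  · rw [seeleyOp_of_le S i σ _ h, map_smul_eq_mul, Real.norm_eq_abs]
    refine mul_le_mul ((hC b le_rfl).trans ?_) (hj1 q ⟨hq, h⟩).le (by positivity) (by positivity)
    nlinarith [mul_nonneg hB0 hC0]
  · obtain ⟨N, hN⟩ := S.exists_forall_reflect_le h τ
    rw [seeleyOp_eq_sum i hσ.2 _ h fun k hk => hN k hk _ le_rfl]
    calc p _ ≤ ∑ k ∈ Finset.range N, |S.c k * S.m k ^ i| * (C * (ε / (C + B * C + 1))) := by
          refine (Finset.le_sum_of_subadditive p (map_zero p).le (map_add_le_add p) _ _).trans (Finset.sum_le_sum fun k _ => ?_)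
          rw [map_smul_eq_mul, Real.norm_eq_abs]
          refine mul_le_mul_of_nonneg_left ?_ (abs_nonneg _)
          have hb := S.reflect_le h.le k
          rcases le_total (b + S.m k * (q.1 - b)) τ with h' | h'
          · rw [hσ.2 _ h', zero_smul, map_zero]; positivity
          · rw [map_smul_eq_mul, Real.norm_eq_abs]
            exact mul_le_mul (hC _ hb) (hj2 (b + S.m k * (q.1 - b), q.2) ⟨⟨h', hb⟩, q, hq, rfl⟩).le
              (by positivity) hC0
      _ ≤ B * (C * (ε / (C + B * C + 1))) := by
          rw [← Finset.sum_mul]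
          exact mul_le_mul_of_nonneg_right
            ((S.summable_abs i).sum_le_tsum _ fun k _ => abs_nonneg _) (by positivity)
      _ ≤ _ := by nlinarith [mul_nonneg hC0 hd.le]

end Topological

section

variable {E : Type u} [TopologicalSpace E]

theorem interior_leftDomain (a : EReal) (b : ℝ) (R : Set E) :
    interior (leftDomain a b R) = {t : ℝ | a < (t : EReal) ∧ t < b} ×ˢ interior R := by
  rw [leftDomain, interior_prod_eq]
  congr 1
  have : {t : ℝ | a < (t : EReal) ∧ t ≤ b} = {t : ℝ | a < (t : EReal)} ∩ Iic b := rfl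
  rw [this, interior_inter, (isOpen_coe_gt a).interior_eq, interior_Iic]
  rfl

theorem interior_rightDomain (a : EReal) (R : Set E) :
    interior (rightDomain a R) = rightDomain a (interior R) := by
  rw [rightDomain, interior_prod_eq, (isOpen_coe_gt a).interior_eq, rightDomain]

end

/-! ### The differential of the reflected sums and the induction on the order. -/

noncomputable section

variable {E : Type u} [AddCommGroup E] [Module ℝ E] [TopologicalSpace E]
  [IsTopologicalAddGroup E] [ContinuousSMul ℝ E]
variable {F : Type v} [AddCommGroup F] [Module ℝ F] [TopologicalSpace F]
  [IsTopologicalAddGroup F] [ContinuousSMul ℝ F] [T2Space F]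

/-- The point q may lie to the left of a: for q.1 < τ the function vanishes near q, and so do both
coefficients. Otherwise this is the product rule. -/
theorem hasDirDerivAt_plateau_smul {a : EReal} {τ b : ℝ} (haτ : a < (τ : EReal)) {σ : ℝ → ℝ}
    (hσ : IsPlateau τ b σ) {R : Set E} {f : ℝ × E → F} {df : (ℝ × E) × (ℝ × E) → F}
    (hdf : IsDifferentialOn (leftDomain a b R) f df) {q v : ℝ × E} (hq : q.1 < b)
    (hqR : q.2 ∈ interior R) :
    HasDirDerivAt (fun p : ℝ × E => σ p.1 • f p) q v
      ((v.1 * deriv σ q.1) • f q + σ q.1 • df (q, v)) := by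
  rcases lt_or_ge q.1 τ with h | h
  · have h1 : (0 : ℝ × E → F) =ᶠ[𝓝 q] fun p => σ p.1 • f p := by
      filter_upwards [continuous_fst.continuousAt.eventually (gt_mem_nhds h)] with z hz
      rw [hσ.2 _ hz.le, zero_smul]; rfl
    rw [hσ.2 _ h.le, hσ.deriv.2 _ h.le, mul_zero, zero_smul, zero_smul, add_zero]
    refine HasDirDerivAt.congr_of_eventuallyEq ?_ h1
    refine tendsto_const_nhds.congr fun t => ?_
    simp [diffQuot]
  · have hint : q ∈ interior (leftDomain a b R) := by
      rw [interior_leftDomain]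
      exact ⟨⟨haτ.trans_le (EReal.coe_le_coe_iff.2 h), hq⟩, hqR⟩
    refine HasDirDerivAt.smul ?_ (hdf.2 q hint v)
    have h1 : HasDirDerivAt σ q.1 1 (deriv σ q.1) :=
      ((hasDerivAt_iff_tendsto_slope_zero.1 (hσ.hasDerivAt q.1))).congr fun t => by
        simp [diffQuot]
    have h2 := h1.smul_dir v.1
    rw [smul_eq_mul, smul_eq_mul, mul_one] at h2
    refine h2.congr fun t => ?_
    simp [diffQuot]

/-- The differential of `seeleyOp S b i σ f`, in terms of the differential `df` of `f`. -/
def seeleyDiff (S : SeeleySequence) (b : ℝ) (i : ℕ) (σ : ℝ → ℝ) (f : ℝ × E → F)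
    (df : (ℝ × E) × (ℝ × E) → F) : (ℝ × E) × (ℝ × E) → F := fun p =>
  p.2.1 • seeleyOp S b (i + 1) (deriv σ) f p.1 +
    p.2.1 • seeleyOp S b (i + 1) σ (fun z => df (z, (1, 0))) p.1 +
    seeleyOp S b i σ (fun z : ℝ × (E × E) => df ((z.1, z.2.1), (0, z.2.2))) (p.1.1, (p.1.2, p.2.2))

/-- Locally the function is σ b • f or a finite sum. Reflection sends a direction (s, y) to (m_k s,
y), and linearity of df isolates the factor m_k in the t-part, which raises i to i + 1 there only.
-/
theorem hasDirDerivAt_seeleyOp_of_ne [LocallyConvexSpace ℝ F] (S : SeeleySequence) {a : EReal}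
    {τ b : ℝ} (haτ : a < (τ : EReal)) (i : ℕ) {σ : ℝ → ℝ} (hσ : IsPlateau τ b σ)
    {R : Set E} (hR : IsRegularSubset R) {f : ℝ × E → F} {df : (ℝ × E) × (ℝ × E) → F}
    (hdf : IsDifferentialOn (leftDomain a b R) f df) {x v : ℝ × E}
    (hx : x ∈ interior (rightDomain a R)) (hxb : x.1 ≠ b) :
    HasDirDerivAt (seeleyOp S b i σ f) x v (seeleyDiff S b i σ f df (x, v)) := by
  rw [interior_rightDomain] at hx
  have hreg := isRegularSubset_leftDomain hR a b
  have hsplit : ∀ q ∈ leftDomain a b R, ∀ s : ℝ, ∀ y : E,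
      df (q, (s, y)) = s • df (q, (1, 0)) + df (q, (0, y)) := by
    intro q hq s y
    rw [← hdf.map_smul hreg hq, ← hdf.map_add hreg hq]
    simp
  rcases hxb.lt_or_gt with h | h
  · have hint : x ∈ interior (leftDomain a b R) := by
      rw [interior_leftDomain]
      exact ⟨⟨hx.1, h⟩, hx.2⟩
    have h1 : (fun z => σ b • f z) =ᶠ[𝓝 x] seeleyOp S b i σ f := by
      filter_upwards [continuous_fst.continuousAt.eventually (gt_mem_nhds h)] with z hz
      rw [seeleyOp_of_le S i σ f hz.le]
    refine HasDirDerivAt.congr_of_eventuallyEq ?_ h1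
    -- For t < b the term with `deriv σ` drops out, as `deriv σ b = 0`; the other two recombine by
    -- linearity of df.
    have h2 : seeleyDiff S b i σ f df (x, v) = σ b • df (x, v) := by
      simp only [seeleyDiff]
      rw [seeleyOp_of_le S _ _ _ h.le, seeleyOp_of_le S _ _ _ h.le,
        seeleyOp_of_le S _ _ _ (show (x.1, (x.2, v.2)).1 ≤ b from h.le), hσ.deriv_eq_zero,
        show df (x, v) = df (x, (v.1, v.2)) from rfl, hsplit x (interior_subset hint) v.1 v.2]
      module
    rw [h2]
    exact (hdf.2 x hint v).const_smul (σ b)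
  · obtain ⟨N, hN, hev⟩ := eventually_seeleyOp_eq_sum (E := E) (F := F) S hσ.2 h
    have hev' := hev i f
    have e : seeleyDiff S b i σ f df (x, v) = ∑ k ∈ Finset.range N, (S.c k * S.m k ^ i) •
        (((S.m k * v.1) * deriv σ (b + S.m k * (x.1 - b))) • f (b + S.m k * (x.1 - b), x.2) +
          σ (b + S.m k * (x.1 - b)) • df ((b + S.m k * (x.1 - b), x.2), (S.m k * v.1, v.2))) := by
      simp only [seeleyDiff]
      rw [seeleyOp_eq_sum _ hσ.2 _ h hN, seeleyOp_eq_sum _ hσ.deriv.2 _ h hN,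
        seeleyOp_eq_sum _ hσ.2 _ (show b < (x.1, (x.2, v.2)).1 from h) hN, Finset.smul_sum,
        Finset.smul_sum, ← Finset.sum_add_distrib, ← Finset.sum_add_distrib]
      refine Finset.sum_congr rfl fun k _ => ?_
      -- Up to τ the reflected point may be outside ]a, b], where df is not known to be linear, but
      -- all coefficients vanish.
      rcases le_or_gt (b + S.m k * (x.1 - b)) τ with h' | h'
      · simp only [hσ.2 _ h', hσ.deriv.2 _ h']
        simp
      · rw [hsplit (b + S.m k * (x.1 - b), x.2) ⟨⟨haτ.trans (EReal.coe_lt_coe_iff.2 h'), S.reflect_le h.le k⟩,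
          interior_subset hx.2⟩ (S.m k * v.1) v.2]
        simp only [pow_succ]
        module
    rw [e]
    refine HasDirDerivAt.congr_of_eventuallyEq ?_ (hev'.mono fun _ hz => hz.symm)
    refine HasDirDerivAt.sum fun k _ => HasDirDerivAt.const_smul _ ?_
    have h1 := hasDirDerivAt_plateau_smul haτ hσ hdf (q := (b + S.m k * (x.1 - b), x.2))
      (v := (S.m k * v.1, v.2)) (S.reflect_lt h k) hx.2
    refine h1.congr fun t => ?_
    simp only [diffQuot, Prod.fst_add, Prod.snd_add, Prod.smul_fst, Prod.smul_snd, smul_eq_mul,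
      Prod.mk_add_mk, Prod.smul_mk]
    rw [show b + S.m k * (x.1 - b) + t * (S.m k * v.1) = b + S.m k * (x.1 + t * v.1 - b) by ring]

variable {ι : Type w} {𝓕 : Filter ι}

/-- The induction on n needs i, σ, E and R general: the differential involves i + 1, `deriv σ`, and
R × E ⊆ E × E, the direction in E being treated as a further space variable. -/
theorem IsCkNullOn.seeleyOp [LocallyConvexSpace ℝ F] (S : SeeleySequence) {a : EReal} {τ b : ℝ}
    (haτ : a < (τ : EReal)) (n : ℕ) : ∀ {E : Type u} [AddCommGroup E] [Module ℝ E]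
    [TopologicalSpace E] [IsTopologicalAddGroup E] [ContinuousSMul ℝ E]
    (i : ℕ) {σ : ℝ → ℝ} (_ : IsPlateau τ b σ) {R : Set E} (_ : IsRegularSubset R)
    {f : ι → ℝ × E → F}, IsCkNullOn 𝓕 n (leftDomain a b R) f →
    IsCkNullOn 𝓕 n (rightDomain a R) fun j => seeleyOp S b i σ (f j) := by
  induction n with
  | zero => intro E _ _ _ _ _ i σ hσ R hR f hf; exact IsNullOn.seeleyOp S haτ i hσ hf
  | succ n ih =>
    intro E _ _ _ _ _ i σ hσ R hR f hf
    have hf0 := hf.of_succ n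
    obtain ⟨hf, df, hdf, hf'⟩ := hf
    have hD : IsCkNullOn 𝓕 n (rightDomain a R ×ˢ (univ : Set (ℝ × E)))
        fun j => seeleyDiff S b i σ (f j) (df j) := by
      have hs : ∀ {g : ι → ℝ × E → F}, IsCkNullOn 𝓕 n (rightDomain a R) g →
          IsCkNullOn 𝓕 n (rightDomain a R ×ˢ (univ : Set (ℝ × E)))
            fun j p => p.2.1 • g j p.1 := fun hg =>
        IsCkNullOn.smul n ((ContinuousLinearMap.fst ℝ ℝ E).comp (ContinuousLinearMap.snd ℝ (ℝ × E) (ℝ × E)))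
          (hg.comp_linear (ContinuousLinearMap.fst ℝ (ℝ × E) (ℝ × E)) (fun p hp => hp.1)
            mapsTo_fst_interior_prod_univ)
      refine IsCkNullOn.add n (IsCkNullOn.add n (hs (ih (i + 1) hσ.deriv hR hf0))
        (hs (ih (i + 1) hσ hR ?_))) ?_
      · have := hf'.comp_affine n (ContinuousLinearMap.inl ℝ (ℝ × E) (ℝ × E))
          ((0, (1, 0)) : (ℝ × E) × (ℝ × E)) (R' := leftDomain a b R) ?_ ?_
        · simpa using this
        · intro p hp
          simpa using hp
        · intro p hp
          rw [interior_prod_eq, interior_univ]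
          simpa using hp
      · have hRu : IsRegularSubset (R ×ˢ (univ : Set E)) := hR.prod (by simp [IsRegularSubset])
        have h1 : IsCkNullOn 𝓕 n (leftDomain a b (R ×ˢ (univ : Set E)))
            fun j (z : ℝ × (E × E)) => df j ((z.1, z.2.1), (0, z.2.2)) := by
          refine hf'.comp_linear (((ContinuousLinearMap.fst ℝ ℝ (E × E)).prod
            ((ContinuousLinearMap.fst ℝ E E).comp (ContinuousLinearMap.snd ℝ ℝ (E × E)))).prod
            ((0 : ℝ × (E × E) →L[ℝ] ℝ).prod
            ((ContinuousLinearMap.snd ℝ E E).comp (ContinuousLinearMap.snd ℝ ℝ (E × E))))) ?_ ?_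
          · intro p hp
            exact ⟨⟨hp.1, hp.2.1⟩, mem_univ _⟩
          · intro p hp
            rw [interior_leftDomain, interior_prod_eq] at hp
            rw [interior_prod_eq, interior_univ, interior_leftDomain]
            exact ⟨⟨hp.1, hp.2.1⟩, mem_univ _⟩
        refine (ih i hσ hRu h1).comp_linear (R' := rightDomain a R ×ˢ (univ : Set (ℝ × E)))
          (((ContinuousLinearMap.fst ℝ ℝ E).comp (ContinuousLinearMap.fst ℝ (ℝ × E) (ℝ × E))).prod
          (((ContinuousLinearMap.snd ℝ ℝ E).comp (ContinuousLinearMap.fst ℝ (ℝ × E) (ℝ × E))).prod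
          ((ContinuousLinearMap.snd ℝ ℝ E).comp (ContinuousLinearMap.snd ℝ (ℝ × E) (ℝ × E)))))
          ?_ ?_
        · intro p hp
          exact ⟨hp.1.1, hp.1.2, mem_univ _⟩
        · intro p hp
          rw [interior_prod_eq, interior_rightDomain] at hp
          rw [interior_rightDomain, interior_prod_eq, interior_univ]
          exact ⟨hp.1.1, hp.1.2, mem_univ _⟩
    refine ⟨hf.seeleyOp S haτ i hσ, _, fun j => ⟨hD.isNullOn.1 j, fun x hx v => ?_⟩, hD⟩
    -- Continuity of `seeleyDiff` across t = b, already contained in `hD`, removes the exceptional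
    -- hyperplane.
    refine hasDirDerivAt_of_ne (D := fun z => seeleyDiff S b i σ (f j) (df j) (z, v))
      isOpen_interior (b := b)
      ((continuousOn_seeleyOp S haτ i hσ (hf.1 j)).mono interior_subset) ?_ ?_ x hx
    · exact (hD.isNullOn.1 j).comp (by fun_prop) fun z hz => ⟨interior_subset hz, mem_univ _⟩
    · exact fun z hz hzb => hasDirDerivAt_seeleyOp_of_ne S haτ i hσ hR (hdf j) hz hzb

end

/-! ### The maps d^{(j)} and their relation to recursive C^n-convergence. -/

section IteratedDifferentials

theorem snoc_comp_succ {E : Type*} {j : ℕ} (y : Fin (j + 1) → E) (v : E) :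
    (fun i : Fin (j + 1) => (Fin.snoc (α := fun _ => E) y v : Fin (j + 2) → E) i.succ) =
      Fin.snoc (α := fun _ => E) (fun i => y i.succ) v := by
  funext i
  refine Fin.lastCases ?_ (fun i => ?_) i
  · rw [Fin.succ_last, Fin.snoc_last, Fin.snoc_last]
  · rw [Fin.succ_castSucc, Fin.snoc_castSucc, Fin.snoc_castSucc]

theorem snoc_zero' {E : Type*} {j : ℕ} (y : Fin (j + 1) → E) (v : E) :
    (Fin.snoc (α := fun _ => E) y v : Fin (j + 2) → E) 0 = y 0 := by
  rw [← Fin.castSucc_zero, Fin.snoc_castSucc]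

variable {F : Type v} [AddCommGroup F] [Module ℝ F] [TopologicalSpace F]

/-- The recursion peels off the direction applied first, whereas differentiating once more appends
one at the end. -/
theorem iterDirDeriv_snoc {E : Type u} [AddCommGroup E] [Module ℝ E] [TopologicalSpace E] (j : ℕ) :
    ∀ (y : Fin j → E) (v : E) (f : E → F),
    iterDirDeriv (j + 1) (Fin.snoc (α := fun _ => E) y v) f = dirDeriv v (iterDirDeriv j y f) := by
  induction j with
  | zero => intro y v f; rfl
  | succ j ih =>
    intro y v f
    rw [iterDirDeriv, snoc_comp_succ, ih, snoc_zero']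
    rfl

variable {E : Type u} [AddCommGroup E] [Module ℝ E] [TopologicalSpace E]

theorem IsCkOn.mono {m n : ℕ} {R : Set E} {f : E → F} (h : IsCkOn n R f) (hmn : m ≤ n) :
    IsCkOn m R f := by
  induction n, hmn using Nat.le_induction with
  | base => exact h
  | succ n _ ih =>
    exact ih (((IsCkOn.isCkNullOn_bot (n + 1) fun _ : Unit => h).of_succ n).isCkOn n ())

variable [IsTopologicalAddGroup E] [ContinuousSMul ℝ E]

theorem iterDirDeriv_congr_of_isOpen (n : ℕ) {U : Set E} (hU : IsOpen U) :
    ∀ {h k : E → F}, (∀ x ∈ U, h x = k x) → ∀ (y : Fin n → E), ∀ x ∈ U,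
    iterDirDeriv n y h x = iterDirDeriv n y k x := by
  induction n with
  | zero => intro h k hk y x hx; exact hk x hx
  | succ n ih =>
    intro h k hk y x hx
    refine ih (fun z hz => ?_) (fun i => y i.succ) x hx
    have hev : ∀ᶠ t : ℝ in 𝓝[≠] 0, diffQuot h z (y 0) t = diffQuot k z (y 0) t := by
      have hc : Continuous fun t : ℝ => z + t • y 0 := by fun_prop
      have hm : ∀ᶠ t : ℝ in 𝓝 0, z + t • y 0 ∈ U :=
        hc.continuousAt.eventually (hU.mem_nhds (by simpa using hz))
      filter_upwards [hm.filter_mono nhdsWithin_le_nhds] with t ht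
      simp [diffQuot, hk _ ht, hk _ hz]
    unfold dirDeriv limUnder
    rw [map_congr hev]

variable [IsTopologicalAddGroup F] [ContinuousSMul ℝ F] [T2Space F]

theorem IsDifferentialOn.dirDeriv_eq {R : Set E} {f : E → F} {df : E × E → F}
    (h : IsDifferentialOn R f df) {x : E} (hx : x ∈ interior R) (v : E) :
    dirDeriv v f x = df (x, v) :=
  (h.2 x hx v).limUnder_eq

/-- Freezing the first direction gives the C^{j+1}-map z ↦ df (z, y 0) on R itself, so the induction
stays on R instead of moving to R × E. -/
theorem IsCkOn.hasDirDerivAt_iterDirDeriv (j : ℕ) : ∀ {R : Set E} {f : E → F},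
    IsCkOn (j + 1) R f → ∀ (y : Fin j → E), ∀ x ∈ interior R, ∀ v,
    HasDirDerivAt (iterDirDeriv j y f) x v
      (iterDirDeriv (j + 1) (Fin.snoc (α := fun _ => E) y v) f x) := by
  induction j with
  | zero =>
    rintro R f ⟨-, df, hdf, -⟩ y x hx v
    rw [iterDirDeriv_snoc]
    exact (hdf.dirDeriv_eq hx v) ▸ hdf.2 x hx v
  | succ j ih =>
    rintro R f ⟨-, df, hdf, hn⟩ y x hx v
    have hg : IsCkOn (j + 1) R fun z => df (z, y 0) := by
      have := ((IsCkOn.isCkNullOn_bot (j + 1) fun _ : Unit => hn).comp_affine (j + 1)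
        (ContinuousLinearMap.inl ℝ E E) ((0, y 0) : E × E) (R' := R)
        (fun z hz => by simpa using hz)
        (fun z hz => by rw [interior_prod_eq, interior_univ]; simpa using hz)).isCkOn _ ()
      simpa using this
    have h1 : ∀ z ∈ interior R, dirDeriv (y 0) f z = df (z, y 0) :=
      fun z hz => hdf.dirDeriv_eq hz _
    have h2 := ih hg (fun i => y i.succ) x hx v
    have e : iterDirDeriv (j + 1 + 1) (Fin.snoc (α := fun _ => E) y v) f =
        iterDirDeriv (j + 1) (Fin.snoc (α := fun _ => E) (fun i => y i.succ) v)
          (dirDeriv (y 0) f) := by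
      rw [iterDirDeriv, snoc_comp_succ, snoc_zero']
    rw [iterDirDeriv, e, iterDirDeriv_congr_of_isOpen _ isOpen_interior h1 _ x hx]
    refine h2.congr_of_eventuallyEq ?_
    filter_upwards [isOpen_interior.mem_nhds hx] with z hz
    exact (iterDirDeriv_congr_of_isOpen _ isOpen_interior h1 _ z hz).symm

theorem IsCkOn.iterDiff_of_mem_interior {n : ℕ} {R : Set E} {f : E → F} (h : IsCkOn n R f) {x : E}
    (hx : x ∈ interior R) (y : Fin n → E) : iterDiff n R f (x, y) = iterDirDeriv n y f x := by
  obtain ⟨g, hg, hgi⟩ := h.exists_continuousOn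
  have hm : (x, y) ∈ interior R ×ˢ (univ : Set (Fin n → E)) := ⟨hx, mem_univ _⟩
  rw [← hgi (x, y) hm]
  refine extendFrom_eq (subset_closure hm) ?_
  have h1 : Tendsto g (𝓝[interior R ×ˢ univ] (x, y)) (𝓝 (g (x, y))) :=
    (hg _ ⟨interior_subset hx, mem_univ _⟩).mono_left
      (nhdsWithin_mono _ (prod_mono interior_subset subset_rfl))
  refine h1.congr' ?_
  filter_upwards [self_mem_nhdsWithin] with q hq using hgi q hq

theorem iterDiff_zero {R : Set E} (hR : IsRegularSubset R) {f : E → F} (h : IsCkOn 0 R f) {x : E}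
    (hx : x ∈ R) (y : Fin 0 → E) : iterDiff 0 R f (x, y) = f x :=
  eqOn_prod_univ_of_interior hR (h.continuousOn_iterDiff hR)
    (g := fun p => f p.1) (ContinuousOn.comp h continuousOn_fst fun _ hp => hp.1)
    (fun _ hz y => h.iterDiff_of_mem_interior hz y) x hx y

theorem IsRegularSubset.prod_univ {X Y : Type*} [TopologicalSpace X] [TopologicalSpace Y]
    {R : Set X} (hR : IsRegularSubset R) : IsRegularSubset (R ×ˢ (univ : Set Y)) :=
  hR.prod (by simp [IsRegularSubset])

/-- The later directions have second component 0 because y 0 is held fixed. Both sides are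
continuous and agree over the interior. -/
theorem iterDiff_succ {n : ℕ} {R : Set E} (hR : IsRegularSubset R) {f : E → F}
    (hf : ContinuousOn f R) {df : E × E → F} (hdf : IsDifferentialOn R f df)
    (hn : IsCkOn n (R ×ˢ (univ : Set E)) df) {x : E} (hx : x ∈ R) (y : Fin (n + 1) → E) :
    iterDiff (n + 1) R f (x, y) =
      iterDiff n (R ×ˢ univ) df ((x, y 0), fun i => ((y i.succ, 0) : E × E)) := by
  have h : IsCkOn (n + 1) R f := ⟨hf, df, hdf, hn⟩
  refine eqOn_prod_univ_of_interior hR (h.continuousOn_iterDiff hR)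
    (g := fun p : E × (Fin (n + 1) → E) => iterDiff n (R ×ˢ univ) df ((p.1, p.2 0), fun i => ((p.2 i.succ, 0) : E × E)))
    ?_ (fun z hz y => ?_) x hx y
  · refine (hn.continuousOn_iterDiff hR.prod_univ).comp (by fun_prop) ?_
    exact fun p hp => ⟨⟨hp.1, mem_univ _⟩, mem_univ _⟩
  · have hi : (z, y 0) ∈ interior (R ×ˢ (univ : Set E)) := by
      rw [interior_prod_eq, interior_univ]
      exact ⟨hz, mem_univ _⟩
    rw [h.iterDiff_of_mem_interior hz, hn.iterDiff_of_mem_interior hi]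
    exact iterDirDeriv_congr n isOpen_interior (h := dirDeriv (y 0) f)
      (fun x' hx' => hdf.dirDeriv_eq hx' _) _ z hz

theorem iterDiff_add (n : ℕ) : ∀ {E : Type u} [AddCommGroup E] [Module ℝ E] [TopologicalSpace E]
    [IsTopologicalAddGroup E] [ContinuousSMul ℝ E] {R : Set E} (_ : IsRegularSubset R)
    {f g : E → F} (_ : IsCkOn n R f) (_ : IsCkOn n R g), ∀ x ∈ R, ∀ y : Fin n → E,
    iterDiff n R (f + g) (x, y) = iterDiff n R f (x, y) + iterDiff n R g (x, y) := by
  induction n with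
  | zero =>
    intro E _ _ _ _ _ R hR f g hf hg x hx y
    rw [iterDiff_zero hR hf hx, iterDiff_zero hR hg hx, iterDiff_zero hR (hf.add 0 hg) hx]
    rfl
  | succ n ih =>
    rintro E _ _ _ _ _ R hR f g ⟨hf, df, hdf, hf'⟩ ⟨hg, dg, hdg, hg'⟩ x hx y
    have hd : IsDifferentialOn R (f + g) (df + dg) := ⟨hdf.1.add hdg.1,
      fun x hx v => (hdf.2 x hx v).add (hdg.2 x hx v)⟩
    rw [iterDiff_succ hR hf hdf hf' hx, iterDiff_succ hR hg hdg hg' hx,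
      iterDiff_succ hR (hf.add hg) hd (hf'.add n hg') hx]
    exact ih hR.prod_univ hf' hg' _ ⟨hx, mem_univ _⟩ _

theorem IsCkOn.isDifferentialOn_iterDiff {j : ℕ} {R : Set E} (hR : IsRegularSubset R) {f : E → F}
    (h : IsCkOn (j + 1) R f) (y : Fin j → E) :
    IsDifferentialOn R (fun x => iterDiff j R f (x, y))
      (fun p => iterDiff (j + 1) R f (p.1, Fin.snoc (α := fun _ => E) y p.2)) := by
  refine ⟨?_, fun x hx v => ?_⟩
  · refine (h.continuousOn_iterDiff hR).comp (Continuous.continuousOn ?_)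
      fun p hp => ⟨hp.1, mem_univ _⟩
    exact continuous_fst.prodMk (continuous_const.finSnoc continuous_snd)
  · simp only
    rw [h.iterDiff_of_mem_interior hx]
    refine (h.hasDirDerivAt_iterDirDeriv j y x hx v).congr_of_eventuallyEq ?_
    filter_upwards [isOpen_interior.mem_nhds hx] with z hz
    rw [(h.mono (Nat.le_succ j)).iterDiff_of_mem_interior hz]

/-- The iterated differentials are multilinear. -/
theorem iterDiff_update [LocallyConvexSpace ℝ F] (j : ℕ) {R : Set E} (hR : IsRegularSubset R)
    {f : E → F} : IsCkOn j R f → ∀ x ∈ R, ∀ (y : Fin j → E) (i : Fin j) (v w : E) (t : ℝ),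
    iterDiff j R f (x, Function.update y i (v + t • w)) =
      iterDiff j R f (x, Function.update y i v) +
        t • iterDiff j R f (x, Function.update y i w) := by
  induction j with
  | zero => intro _ x _ y i; exact i.elim0
  | succ j ih =>
    intro h x hx y i v w t
    have ih' := ih (h.mono (Nat.le_succ j))
    obtain ⟨y, u, rfl⟩ : ∃ (y' : Fin j → E) (u : E), y = Fin.snoc (α := fun _ => E) y' u :=
      ⟨Fin.init y, y (Fin.last j), (Fin.snoc_init_self y).symm⟩
    revert i
    refine Fin.lastCases ?_ (fun i => ?_)
    -- The last slot is the direction of a differential, hence linear.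
    · simp only [Fin.update_snoc_last]
      have hd := h.isDifferentialOn_iterDiff hR y
      have h1 := hd.map_add hR hx v (t • w)
      have h2 := hd.map_smul hR hx t w
      simp only at h1 h2
      rw [h1, h2]
    -- In the other slots, the identity for order j is differentiated in the direction u.
    · simp only [← Fin.snoc_update]
      have hd := fun z => h.isDifferentialOn_iterDiff hR (Function.update y i z)
      refine eqOn_of_interior hR ((hd (v + t • w)).continuousOn_dir u)
        (((hd v).continuousOn_dir u).add (((hd w).continuousOn_dir u).const_smul t))
        (fun z hz => ?_) x hx
      refine HasDirDerivAt.unique ((hd (v + t • w)).2 z hz u) ?_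
      refine HasDirDerivAt.congr_of_eventuallyEq
        (((hd v).2 z hz u).add (((hd w).2 z hz u).const_smul t)) ?_
      filter_upwards [isOpen_interior.mem_nhds hz] with q hq
      exact (ih' q (interior_subset hq) y i v w t).symm

/-- The differential of `d^{(m)} f` on `R × E^m`. -/
theorem IsCkOn.isDifferentialOn_iterDiff_prod [LocallyConvexSpace ℝ F] {m : ℕ} {R : Set E}
    (hR : IsRegularSubset R) {f : E → F} (h : IsCkOn (m + 1) R f) :
    IsDifferentialOn (R ×ˢ (univ : Set (Fin m → E))) (iterDiff m R f)
      (fun p => iterDiff (m + 1) R f (p.1.1, Fin.snoc (α := fun _ => E) p.1.2 p.2.1) +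
        ∑ i, iterDiff m R f (p.1.1, Function.update p.1.2 i (p.2.2 i))) := by
  classical
  have hm := h.mono (Nat.le_succ m)
  have hc := hm.continuousOn_iterDiff hR
  refine ⟨?_, ?_⟩
  · refine ContinuousOn.add ?_ (continuousOn_finsetSum _ fun i _ => ?_)
    · refine (h.continuousOn_iterDiff hR).comp (Continuous.continuousOn ?_)
        fun p hp => ⟨hp.1.1, mem_univ _⟩
      exact (continuous_fst.comp continuous_fst).prodMk
        (Continuous.finSnoc (continuous_snd.comp continuous_fst)
          (continuous_fst.comp continuous_snd))
    · refine hc.comp (Continuous.continuousOn ?_) fun p hp => ⟨hp.1.1, mem_univ _⟩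
      exact (continuous_fst.comp continuous_fst).prodMk
        ((continuous_snd.comp continuous_fst).update i (by fun_prop))
  · rintro ⟨x, y⟩ hxy ⟨u, w⟩
    have hx : x ∈ interior R := mapsTo_fst_interior_prod_univ hxy
    -- Only the components in A move. Enlarging A by one index changes the difference quotient, by
    -- multilinearity, by exactly one term, whose limit follows from continuity of d^{(m)} f.
    set yA : Finset (Fin m) → ℝ → Fin m → E :=
      fun A t i => if i ∈ A then y i + t • w i else y i with hyA
    have hyc : ∀ A, Continuous (yA A) := fun A => by
      refine continuous_pi fun i => ?_
      by_cases hi : i ∈ A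
      · simp only [hyA, hi, if_true]; fun_prop
      · simp only [hyA, hi, if_false]; fun_prop
    have key : ∀ A : Finset (Fin m), Tendsto
        (fun t : ℝ => t⁻¹ • (iterDiff m R f (x + t • u, yA A t) - iterDiff m R f (x, y)))
        (𝓝[≠] 0) (𝓝 (iterDiff (m + 1) R f (x, Fin.snoc (α := fun _ => E) y u) +
          ∑ i ∈ A, iterDiff m R f (x, Function.update y i (w i)))) := by
      intro A
      induction A using Finset.induction_on with
      | empty =>
        have e : yA ∅ = fun _ => y := by
          funext t i
          simp [hyA]
        rw [e, Finset.sum_empty, add_zero]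
        exact (h.isDifferentialOn_iterDiff hR y).2 x hx u
      | insert a A ha ih =>
        rw [Finset.sum_insert ha, add_left_comm, add_comm]
        have hlim : Tendsto
            (fun t : ℝ => iterDiff m R f (x + t • u, Function.update (yA A t) a (w a)))
            (𝓝[≠] 0) (𝓝 (iterDiff m R f (x, Function.update y a (w a)))) := by
          have h1 : Continuous fun t : ℝ =>
              ((x + t • u, Function.update (yA A t) a (w a)) : E × (Fin m → E)) :=
            Continuous.prodMk (by fun_prop) ((hyc A).update a continuous_const)
          have h2 : yA A 0 = y := by
            funext i
            simp [hyA]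
          have h3 := (h1.tendsto 0).mono_left (nhdsWithin_le_nhds (s := {0}ᶜ))
          simp only [zero_smul, add_zero, h2] at h3
          refine (hc.continuousAt ?_).tendsto.comp h3
          exact prod_mem_nhds (mem_interior_iff_mem_nhds.1 hx) univ_mem
        refine (ih.add hlim).congr' ?_
        have hev : ∀ᶠ t : ℝ in 𝓝[≠] 0, x + t • u ∈ R := by
          have hcu : Continuous fun t : ℝ => x + t • u := by fun_prop
          have : ∀ᶠ t : ℝ in 𝓝 0, x + t • u ∈ R :=
            hcu.continuousAt.eventually_mem
              (by simpa using mem_interior_iff_mem_nhds.1 hx)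
          exact this.filter_mono nhdsWithin_le_nhds
        filter_upwards [hev, self_mem_nhdsWithin] with t ht ht0
        have e : yA (insert a A) t = Function.update (yA A t) a (yA A t a + t • w a) := by
          funext i
          rcases eq_or_ne i a with rfl | hi
          · simp [hyA, ha]
          · simp [hyA, hi]
        rw [e, iterDiff_update m hR hm _ ht, Function.update_eq_self]
        have ht0' : t ≠ 0 := ht0
        rw [add_sub_right_comm, smul_add t⁻¹, inv_smul_smul₀ ht0']
    refine (key Finset.univ).congr fun t => ?_
    simp only [diffQuot, hyA, Finset.mem_univ, if_true]
    rfl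

variable {ι : Type w} {𝓕 : Filter ι}

/-- The continuous linear map `((x, y), (u, w)) ↦ (x, (y, u))`. -/
def snocCLM (E : Type u) [AddCommGroup E] [Module ℝ E] [TopologicalSpace E] (m : ℕ) :
    ((E × (Fin m → E)) × (E × (Fin m → E))) →L[ℝ] E × (Fin (m + 1) → E) where
  toFun p := (p.1.1, Fin.snoc (α := fun _ => E) p.1.2 p.2.1)
  map_add' p q := by
    refine Prod.ext rfl (funext fun i => ?_)
    refine Fin.lastCases ?_ (fun i => ?_) i <;> simp
  map_smul' c p := by
    refine Prod.ext rfl (funext fun i => ?_)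
    refine Fin.lastCases ?_ (fun i => ?_) i <;> simp
  cont := (continuous_fst.comp continuous_fst).prodMk
    (Continuous.finSnoc (continuous_snd.comp continuous_fst) (continuous_fst.comp continuous_snd))

/-- The continuous linear map which replaces the `i`-th component of `y` by that of `w` in
`((x, y), (u, w)) ↦ (x, y)`. -/
def updateCLM (E : Type u) [AddCommGroup E] [Module ℝ E] [TopologicalSpace E] (m : ℕ)
    (i : Fin m) : ((E × (Fin m → E)) × (E × (Fin m → E))) →L[ℝ] E × (Fin m → E) where
  toFun p := (p.1.1, Function.update p.1.2 i (p.2.2 i))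
  map_add' p q := by
    refine Prod.ext rfl (funext fun k => ?_)
    rcases eq_or_ne k i with rfl | h <;> simp [*]
  map_smul' c p := by
    refine Prod.ext rfl (funext fun k => ?_)
    rcases eq_or_ne k i with rfl | h <;> simp [*]
  cont := (continuous_fst.comp continuous_fst).prodMk
    ((continuous_snd.comp continuous_fst).update i (by fun_prop))

/-- All m are treated at once: the differential of d^{(m)} f consists of d^{(m+1)} f and d^{(m)} f
composed with continuous linear maps, so one order is traded for at most one step in m. -/
theorem isCkNullOn_iterDiff [LocallyConvexSpace ℝ F] {N : ℕ} {R : Set E} (hR : IsRegularSubset R)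
    {f : ι → E → F} (hC : ∀ i, IsCkOn N R (f i))
    (h : ∀ j ≤ N, IsNullOn 𝓕 (R ×ˢ (univ : Set (Fin j → E))) fun i => iterDiff j R (f i)) (n : ℕ) :
    ∀ m, m + n ≤ N →
    IsCkNullOn 𝓕 n (R ×ˢ (univ : Set (Fin m → E))) fun i => iterDiff m R (f i) := by
  induction n with
  | zero => exact fun m hm => h m hm
  | succ n ih =>
    intro m hm
    refine ⟨h m (by omega), _, fun i =>
      ((hC i).mono (show m + 1 ≤ N by omega)).isDifferentialOn_iterDiff_prod hR, ?_⟩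
    have hmap : ∀ {k : ℕ} (L : ((E × (Fin m → E)) × (E × (Fin m → E))) →L[ℝ] E × (Fin k → E)),
        (∀ p, (L p).1 = p.1.1) → k + n ≤ N →
        IsCkNullOn 𝓕 n ((R ×ˢ (univ : Set (Fin m → E))) ×ˢ (univ : Set (E × (Fin m → E))))
          fun i p => iterDiff k R (f i) (L p) := by
      intro k L hL hk
      refine (ih k hk).comp_linear L (fun p hp => ⟨?_, mem_univ _⟩) fun p hp => ?_
      · rw [hL]; exact hp.1.1
      · simp only [interior_prod_eq, interior_univ] at hp ⊢
        refine ⟨?_, mem_univ _⟩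
        rw [hL]; exact hp.1.1
    have h1 := hmap (snocCLM E m) (fun _ => rfl) (by omega)
    have h2 := IsCkNullOn.sum (s := Finset.univ) fun i _ =>
      hmap (updateCLM E m i) (fun _ => rfl) (by omega)
    refine (h1.add n h2).congr fun i p _ => ?_
    simp only [Pi.add_apply, Finset.sum_apply]
    rfl

/-- This is the case m = 0 of `isCkNullOn_iterDiff`, transported along x ↦ (x, 0) from R to R × E^0.
-/
theorem isCkNullOn_of_iterDiff [LocallyConvexSpace ℝ F] {n : ℕ} {R : Set E}
    (hR : IsRegularSubset R) {f : ι → E → F} (hC : ∀ i, IsCkOn n R (f i))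
    (h : ∀ j ≤ n, IsNullOn 𝓕 (R ×ˢ (univ : Set (Fin j → E))) fun i => iterDiff j R (f i)) :
    IsCkNullOn 𝓕 n R f := by
  have h0 := isCkNullOn_iterDiff hR hC h n 0 (by omega)
  refine (h0.comp_linear (ContinuousLinearMap.inl ℝ E (Fin 0 → E)) (R' := R)
    (fun x hx => ⟨hx, mem_univ _⟩) fun x hx => ?_).congr fun i x hx => ?_
  · rw [interior_prod_eq, interior_univ]
    exact ⟨hx, mem_univ _⟩
  · exact iterDiff_zero hR ((hC i).mono (Nat.zero_le n)) hx _

theorem IsCkNullOn.isNullOn_iterDiff (n : ℕ) : ∀ {E : Type u} [AddCommGroup E] [Module ℝ E]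
    [TopologicalSpace E] [IsTopologicalAddGroup E] [ContinuousSMul ℝ E] {R : Set E}
    (_ : IsRegularSubset R) {f : ι → E → F}, IsCkNullOn 𝓕 n R f →
    IsNullOn 𝓕 (R ×ˢ (univ : Set (Fin n → E))) fun i => iterDiff n R (f i) := by
  induction n with
  | zero =>
    intro E _ _ _ _ _ R hR f hf
    refine (IsNullOn.comp (φ := fun p : E × (Fin 0 → E) => p.1) hf (by fun_prop)
      fun p hp => hp.1).congr fun i p hp => ?_
    exact (iterDiff_zero hR (hf.isCkOn 0 i) hp.1 _).symm
  | succ n ih =>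
    rintro E _ _ _ _ _ R hR f ⟨hf, df, hdf, hf'⟩
    refine (IsNullOn.comp (ih hR.prod_univ hf') (R' := R ×ˢ (univ : Set (Fin (n + 1) → E)))
      (φ := fun p => ((p.1, p.2 0), fun i => ((p.2 i.succ, 0) : E × E))) (by fun_prop)
      fun p hp => ⟨⟨hp.1, mem_univ _⟩, mem_univ _⟩).congr fun i p hp => ?_
    exact (iterDiff_succ hR (hf.1 i) (hdf i) (hf'.isCkOn n i) hp.1 _).symm

end IteratedDifferentials

/-! ### The compact-open C^ℓ-topology in terms of null families. -/

section FunctionSpace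

variable {E : Type u} [AddCommGroup E] [Module ℝ E] [TopologicalSpace E]
  [IsTopologicalAddGroup E] [ContinuousSMul ℝ E]
variable {F : Type v} [AddCommGroup F] [Module ℝ F] [TopologicalSpace F]
  [IsTopologicalAddGroup F] [ContinuousSMul ℝ F]

theorem tendsto_compactOpen_iff_seminorm [LocallyConvexSpace ℝ F] {X : Type*} [TopologicalSpace X]
    {ι : Type w} {l : Filter ι} {G : ι → C(X, F)} {g : C(X, F)} :
    Tendsto G l (𝓝 g) ↔ ∀ K : Set X, IsCompact K → ∀ p : Seminorm ℝ F, Continuous p →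
      ∀ ε > 0, ∀ᶠ i in l, ∀ x ∈ K, p (G i x - g x) < ε := by
  let _ := IsTopologicalAddGroup.rightUniformSpace F
  have := isUniformAddGroup_of_addCommGroup (G := F)
  rw [ContinuousMap.tendsto_iff_forall_isCompact_tendstoUniformlyOn]
  refine forall₂_congr fun K _ => ?_
  rw [tendstoUniformlyOn_iff_tendsto, uniformity_eq_comap_nhds_zero, tendsto_comap_iff]
  refine ⟨fun h p hp ε hε => ?_, fun h => tendsto_of_seminorm fun p hp ε hε => ?_⟩
  · have := eventually_seminorm_lt h hp hε
    rw [eventually_prod_principal_iff] at this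
    simpa using this
  · rw [eventually_prod_principal_iff]
    simpa using h p hp ε hε

variable [T2Space F]

theorem zeroExt_apply {X : Type*} [AddCommGroup X] {R : Set X} (γ : R → F) (x : R) :
    zeroExt γ (x : X) = γ x :=
  Subtype.val_injective.extend_apply _ _ x

/-- Additivity of d^{(j)} reduces to differences. Compact sets in the subtype and compact subsets of
R × E^j correspond because the inclusion is inducing. -/
theorem CkSpace.tendsto_d_iff [LocallyConvexSpace ℝ F] {ℓ : ℕ∞} {R : Set E}
    (hR : IsRegularSubset R) {j : ℕ} (hj : (j : ℕ∞) ≤ ℓ) {ι : Type w} {l : Filter ι}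
    {γ : ι → CkSpace ℓ R F} {γ₀ : CkSpace ℓ R F} :
    Tendsto (fun i => CkSpace.d hR j hj (γ i)) l (𝓝 (CkSpace.d hR j hj γ₀)) ↔
      IsNullOn l (R ×ˢ (univ : Set (Fin j → E)))
        fun i => iterDiff j R (zeroExt (γ i - γ₀).1) := by
  have hsub : ∀ i, ∀ p : R × (Fin j → E), CkSpace.d hR j hj (γ i) p - CkSpace.d hR j hj γ₀ p =
      iterDiff j R (zeroExt (γ i - γ₀).1) (p.1, p.2) := by
    intro i p
    have h := iterDiff_add j hR ((γ i - γ₀).2 j hj) (γ₀.2 j hj) p.1 p.1.2 p.2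
    rw [← zeroExt_add] at h
    have e : (γ i - γ₀).1 + γ₀.1 = (γ i).1 := by simp
    rw [e] at h
    simp only [CkSpace.d, ContinuousMap.coe_mk, h, add_sub_cancel_right]
  rw [tendsto_compactOpen_iff_seminorm]
  have hind : IsInducing fun p : R × (Fin j → E) => ((p.1 : E), p.2) :=
    IsInducing.subtypeVal.prodMap IsInducing.id
  constructor
  · refine fun h => ⟨fun i => IsCkOn.continuousOn_iterDiff hR ((γ i - γ₀).2 j hj),
      fun K hK hKc p hp ε hε => ?_⟩
    have hK' : IsCompact ((fun p : R × (Fin j → E) => ((p.1 : E), p.2)) ⁻¹' K) :=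
      hind.isCompact_preimage' hKc fun q hq => ⟨(⟨q.1, (hK hq).1⟩, q.2), rfl⟩
    filter_upwards [h _ hK' p hp ε hε] with i hi q hq
    have := hi (⟨q.1, (hK hq).1⟩, q.2) hq
    rwa [hsub] at this
  · intro h K hK p hp ε hε
    filter_upwards [h.2 ((fun p : R × (Fin j → E) => ((p.1 : E), p.2)) '' K)
      (by rintro _ ⟨q, -, rfl⟩; exact ⟨q.1.2, mem_univ _⟩) (hK.image hind.continuous) p hp ε hε]
      with i hi q hq
    rw [hsub]
    exact hi _ (mem_image_of_mem _ hq)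

/-- The space indexes its own elements: along the neighbourhood filter of γ₀, the identity converges
to γ₀. -/
theorem CkSpace.tendsto_ckTopology [LocallyConvexSpace ℝ F] {ℓ : ℕ∞} {R : Set E}
    (hR : IsRegularSubset R) (γ₀ : CkSpace ℓ R F) {n : ℕ} (hn : (n : ℕ∞) ≤ ℓ) :
    IsCkNullOn (@nhds _ (ckTopology ℓ hR) γ₀) n R
      fun γ : CkSpace ℓ R F => zeroExt (γ - γ₀).1 := by
  refine isCkNullOn_of_iterDiff hR (fun γ => (γ - γ₀).2 n hn) fun j hj => ?_
  have hjℓ : (j : ℕ∞) ≤ ℓ := le_trans (by exact_mod_cast hj) hn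
  refine (CkSpace.tendsto_d_iff hR hjℓ (γ := fun γ => γ)).1 ?_
  have h1 : Continuous[ckTopology ℓ hR, ContinuousMap.compactOpen]
      (CkSpace.d (F := F) hR j hjℓ) :=
    continuous_iff_le_induced.2 (iInf₂_le j hjℓ)
  exact (@Continuous.tendsto _ _ (ckTopology ℓ hR) _ _ h1 γ₀)

theorem continuous_ckTopology_of_isCkNullOn {E' : Type u} [AddCommGroup E'] [Module ℝ E']
    [TopologicalSpace E'] [IsTopologicalAddGroup E'] [ContinuousSMul ℝ E'] [LocallyConvexSpace ℝ F]
    {ℓ : ℕ∞} {R : Set E} (hR : IsRegularSubset R) {R' : Set E'} (hR' : IsRegularSubset R')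
    (T : CkSpace ℓ R F →ₗ[ℝ] CkSpace ℓ R' F)
    (hT : ∀ (n : ℕ) (γ₀ : CkSpace ℓ R F), (n : ℕ∞) ≤ ℓ →
      IsCkNullOn (@nhds _ (ckTopology ℓ hR) γ₀) n R'
        fun γ : CkSpace ℓ R F => zeroExt (T (γ - γ₀)).1) :
    Continuous[ckTopology ℓ hR, ckTopology ℓ hR'] T := by
  refine continuous_iInf_rng.2 fun j => continuous_iInf_rng.2 fun hj => continuous_induced_rng.2 ?_
  refine (@continuous_iff_continuousAt _ _ (ckTopology ℓ hR) _ _).2 fun γ₀ => ?_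
  refine (CkSpace.tendsto_d_iff hR' hj (γ := fun γ => T γ)).2 ?_
  have := (hT j γ₀ hj).isNullOn_iterDiff j hR'
  simpa only [map_sub] using this

end FunctionSpace

/-! ### Linearity of the reflected sums and identification with the extension operator. -/

section Extension

variable {E : Type u} [AddCommGroup E]
variable {F : Type v} [AddCommGroup F] [Module ℝ F]

theorem seeleyOp_add {S : SeeleySequence} {τ b : ℝ} (i : ℕ) {σ : ℝ → ℝ}
    (hσ : ∀ t ≤ τ, σ t = 0) (f g : ℝ × E → F) :
    seeleyOp S b i σ (f + g) = seeleyOp S b i σ f + seeleyOp S b i σ g := by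
  funext p
  rw [Pi.add_apply]
  rcases le_or_gt p.1 b with h | h
  · simp only [seeleyOp_of_le S i σ _ h, Pi.add_apply, smul_add]
  · obtain ⟨N, hN⟩ := S.exists_forall_reflect_le h τ
    simp only [seeleyOp_eq_sum i hσ _ h fun k hk => hN k hk _ le_rfl, Pi.add_apply, smul_add,
      Finset.sum_add_distrib]

theorem seeleyOp_smul {S : SeeleySequence} {τ b : ℝ} (i : ℕ) {σ : ℝ → ℝ}
    (hσ : ∀ t ≤ τ, σ t = 0) (c : ℝ) (f : ℝ × E → F) :
    seeleyOp S b i σ (c • f) = c • seeleyOp S b i σ f := by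
  funext p
  rw [Pi.smul_apply]
  rcases le_or_gt p.1 b with h | h
  · simp only [seeleyOp_of_le S i σ _ h, Pi.smul_apply, smul_comm c]
  · obtain ⟨N, hN⟩ := S.exists_forall_reflect_le h τ
    simp only [seeleyOp_eq_sum i hσ _ h fun k hk => hN k hk _ le_rfl, Pi.smul_apply,
      Finset.smul_sum, smul_comm c]

theorem hanuschExt_eq_seeleyOp {S : SeeleySequence} {τ b : ℝ} {ρ : ℝ → ℝ} (hρ : IsCutoff τ b ρ)
    {a : EReal} {R : Set E} (γ : leftDomain a b R → F) (p : rightDomain a R) :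
    hanuschExt S ρ γ p = seeleyOp S b 0 ρ (zeroExt γ) p := by
  rw [hanuschExt]
  split_ifs with h
  · rw [seeleyOp_of_le S 0 ρ _ h, hρ.3.self_of_nhds, one_smul]
    exact (Subtype.val_injective.extend_apply γ 0
      (⟨p.1, ⟨p.2.1, h⟩, p.2.2⟩ : leftDomain a b R)).symm
  · rw [seeleyOp, if_neg h]
    simp only [pow_zero, mul_one]

end Extension

end Bastiani

theorem proposition1p7
    {E : Type*} [AddCommGroup E] [Module ℝ E] [TopologicalSpace E] [IsTopologicalAddGroup E]
    [ContinuousSMul ℝ E] [LocallyConvexSpace ℝ E] [T2Space E]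
    {F : Type*} [AddCommGroup F] [Module ℝ F] [TopologicalSpace F] [IsTopologicalAddGroup F]
    [ContinuousSMul ℝ F] [LocallyConvexSpace ℝ F] [T2Space F]
    (ℓ : ℕ∞) (R : Set E) (hR : Bastiani.IsRegularSubset R)
    (a : EReal) (τ b : ℝ) (haτ : a < (τ : EReal)) (hτb : τ < b)
    (S : Bastiani.SeeleySequence) (ρ : ℝ → ℝ) (hρ : Bastiani.IsCutoff τ b ρ) :
    ∃ T : Bastiani.CkSpace ℓ (Bastiani.leftDomain a b R) F →ₗ[ℝ]
        Bastiani.CkSpace ℓ (Bastiani.rightDomain a R) F,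
      (∀ γ, (T γ).1 = Bastiani.hanuschExt S ρ γ.1) ∧
      (∀ γ, ∀ p : Bastiani.leftDomain a b R,
        (T γ).1 ⟨p.1, Bastiani.leftDomain_subset_rightDomain a b R p.2⟩ = γ.1 p) ∧
      Continuous[Bastiani.ckTopology ℓ (Bastiani.isRegularSubset_leftDomain hR a b),
        Bastiani.ckTopology ℓ (Bastiani.isRegularSubset_rightDomain hR a)] T := by
  -- Used twice, with the function space as index type: along ⊥ it shows that extensions are C^n,
  -- along neighbourhood filters that the operator is continuous.
  have hnull : ∀ {ι : Type _} {𝓕 : Filter ι} {n : ℕ}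
      {γ : ι → Bastiani.CkSpace ℓ (Bastiani.leftDomain a b R) F},
      Bastiani.IsCkNullOn 𝓕 n (Bastiani.leftDomain a b R)
        (fun i => Bastiani.zeroExt (γ i).1) →
      Bastiani.IsCkNullOn 𝓕 n (Bastiani.rightDomain a R)
        (fun i => Bastiani.zeroExt (Bastiani.hanuschExt S ρ (γ i).1)) := by
    intro ι 𝓕 n γ h
    refine (h.seeleyOp S haτ n 0 hρ.isPlateau hR).congr fun i x hx => ?_
    rw [← Bastiani.hanuschExt_eq_seeleyOp hρ (γ i).1 ⟨x, hx⟩]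
    exact (Bastiani.zeroExt_apply (Bastiani.hanuschExt S ρ (γ i).1) ⟨x, hx⟩).symm
  let T : Bastiani.CkSpace ℓ (Bastiani.leftDomain a b R) F →ₗ[ℝ]
      Bastiani.CkSpace ℓ (Bastiani.rightDomain a R) F :=
    { toFun := fun γ => ⟨Bastiani.hanuschExt S ρ γ.1, fun n hn =>
        (hnull (Bastiani.IsCkOn.isCkNullOn_bot n
          fun γ : Bastiani.CkSpace ℓ (Bastiani.leftDomain a b R) F => γ.2 n hn)).isCkOn n γ⟩
      map_add' := fun γ η => by
        refine Subtype.ext (funext fun p => ?_)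
        change Bastiani.hanuschExt S ρ (γ.1 + η.1) p =
          Bastiani.hanuschExt S ρ γ.1 p + Bastiani.hanuschExt S ρ η.1 p
        simp only [Bastiani.hanuschExt_eq_seeleyOp hρ, Bastiani.zeroExt_add,
          Bastiani.seeleyOp_add 0 hρ.2, Pi.add_apply]
      map_smul' := fun c γ => by
        refine Subtype.ext (funext fun p => ?_)
        change Bastiani.hanuschExt S ρ (c • γ.1) p = c • Bastiani.hanuschExt S ρ γ.1 p
        simp only [Bastiani.hanuschExt_eq_seeleyOp hρ, Bastiani.zeroExt_smul,
          Bastiani.seeleyOp_smul 0 hρ.2, Pi.smul_apply] }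
  refine ⟨T, fun γ => rfl, fun γ p => ?_, ?_⟩
  · exact dif_pos p.2.1.2
  · exact Bastiani.continuous_ckTopology_of_isCkNullOn _ _ T fun n γ₀ hn =>
      hnull (Bastiani.CkSpace.tendsto_ckTopology _ γ₀ hn)
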